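/- Work over $\mathbb{C}$. Let $\mathcal{L}$ be a twisted affine Lie superalgebra of one of the types $A(2m,2n-1)^{(2)}$ ($m\ge 0$, $n\ge 1$), $A(2m-1,2n-1)^{(2)}$ ($m,n\ge 1$, $(m,n)\ne(1,1)$), $A(2m,2n)^{(4)}$ ($m,n\ge 0$, $(m,n)\neq(0,0)$), $D(m+1,n)^{(2)}$ ($m\ge 0$, $n\ge 1$). That is, let $\mathscr{T}$ be the basic classical simple Lie superalgebra of type $A(2m,2n-1)$, $A(2m-1,2n-1)$, $A(2m,2n)$, $D(m+1,n)$, respectively, with standard Cartan subalgebra $H$, and let $\sigma$ be the standard automorphism of order $l=2,2,4,2$, respectively, with $\sigma(H)\subseteq H$. In the $A$-cases $\mathscr{T}$ is $\mathfrak{sl}(2m+1|2n)$, $\mathfrak{sl}(2m|2n)$, $\mathfrak{sl}(2m+1|2n+1)$ modulo the scalar matrices it contains, and $\sigma(X)=-B^{-1}X^{st}B$, where $B$ is the matrix of an even bilinear form that is symmetric on the even part of the underlying superspace and, on the odd part, skew-symmetric of rank $2n$, plus, in the last case, $1$ on one further odd basis vector. In the $D$-case $\mathscr{T}=\mathfrak{osp}(2m+2|2n)$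 and $\sigma$ is conjugation by a reflection of the even part. Let $\mathfrak{h}=\{x\in H\mid\sigma(x)=x\}$, let $\zeta$ be a primitive $l$-th root of unity, and for $k\in\mathbb{Z}$ and $\dot\alpha\in\mathfrak{h}^*$ put $${}^{[k]}\mathscr{T}=\{x\in\mathscr{T}\mid\sigma(x)=\zeta^kx\},\qquad {}^{[k]}\mathscr{T}^{(\dot\alpha)}=\{x\in{}^{[k]}\mathscr{T}\mid[h,x]=\dot\alpha(h)x\ \text{for all } h\in\mathfrak{h}\}.$$ The centerless core of $\mathcal{L}$ (the quotient of $\mathcal{L}_c=\bigoplus_k({}^{[k]}\mathscr{T}\otimes t^k)\oplus\mathbb{C}c$ by its central line $\mathbb{C}c$) is $\mathcal{L}_{cc}=\bigoplus_{k\in\mathbb{Z}}{}^{[k]}\mathscr{T}\otimes t^k$ with bracket $[x\otimes t^p,y\otimes t^q]=[x,y]\otimes t^{p+q}$. The root system is $R=\{\dot\alpha+k\delta\mid{}^{[k]}\mathscr{T}^{(\dot\alpha)}\neq 0\}$. The root space of $\dot\alpha+k\delta\ne0$ is $\mathcal{L}^{\dot\alpha+k\delta}={}^{[k]}\mathscr{T}^{(\dot\alpha)}\otimes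 t^k$. Let $R_0$ be the set of roots whose root space meets the even part nontrivially; in particular $0\in R_0$. Let $S\subseteq R_0$ satisfy * $S=-S$ and $(S+S)\cap R\subseteq S$; * $R\cap\big((S\setminus\mathbb{Z}\delta)+\mathbb{Z}\delta\big)\subseteq S$; * $2\mathbb{Z}\delta\subseteq S$. Put $\dot S=\{\dot\alpha\in\mathfrak{h}^*\mid\dot\alpha+k\delta\in S\text{ for some }k\in\mathbb{Z}\}$ and $$\mathscr{F}(S)_{cc}=\mathfrak{h}+\sum_{0\ne\alpha\in S}\mathcal{L}^\alpha+\sum_{k\in\mathbb{Z}}\mathcal{L}^{(2k+1)\delta},$$ a subalgebra of $\mathcal{L}_{cc}$. Let $V=V_0\oplus V_1$ be a simple $\mathscr{F}(S)_{cc}$-supermodule (nonzero, with no graded submodules other than $0$ and $V$) that is a finite $\mathfrak{h}$-weight module, i.e. $V=\bigoplus_{\lambda\in\mathfrak{h}^*}V^\lambda$ with all weight spaces $V^\lambda=\{v\mid hv=\lambda(h)v\ \text{for all } h\in\mathfrak{h}\}$ finite dimensional, and let $\mathrm{supp}(V)=\{\lambda\in\mathfrak{h}^*\mid V^\lambda\ne0\}$.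 Then for every $0\ne\dot\alpha\in\dot S$ the following are equivalent: 1. for every $\lambda\in\mathrm{supp}(V)$ there are only finitely many integers $s>0$ with $\lambda+s\dot\alpha\in\mathrm{supp}(V)$; 2. there is $\lambda\in\mathrm{supp}(V)$ such that there are only finitely many integers $s>0$ with $\lambda+s\dot\alpha\in\mathrm{supp}(V)$; 3. for every $k\in\mathbb{Z}$ with $\dot\alpha+k\delta\in S$, every nonzero $x\in\mathcal{L}^{\dot\alpha+k\delta}$ acts locally nilpotently on $V$; 4. there are $k\in\mathbb{Z}$ with $\dot\alpha+k\delta\in S$ and a nonzero $x\in\mathcal{L}^{\dot\alpha+k\delta}$ that acts locally nilpotently on $V$. -/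

import Mathlib

noncomputable section

namespace TwistedAffine

/-! ### The general linear Lie superalgebra modulo scalars -/

section LinearSuper

variable {I : Type} (par : I → ZMod 2)

/-- The component of parity `e` of a matrix over an index set with parities. -/
def comp (e : ZMod 2) : Matrix I I ℂ →ₗ[ℂ] Matrix I I ℂ where
  toFun X := Matrix.of fun i j => if par i + par j = e then X i j else 0
  map_add' X Y := by
    ext i j
    by_cases h : par i + par j = e <;> simp [h]
  map_smul' c X := by
    ext i j
    by_cases h : par i + par j = e <;> simp [h]

/-- Matrices that are homogeneous of parity `e`. -/
def homog (e : ZMod 2) : Submodule ℂ (Matrix I I ℂ) where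
  carrier := {X | ∀ i j, par i + par j ≠ e → X i j = 0}
  zero_mem' := by
    intro i j _
    rfl
  add_mem' := by
    intro X Y hX hY i j h
    simp [hX i j h, hY i j h]
  smul_mem' := by
    intro c X hX i j h
    simp [hX i j h]

theorem comp_add_comp (X : Matrix I I ℂ) : comp par 0 X + comp par 1 X = X := by
  ext i j
  have : ∀ a : ZMod 2, a = 0 ∨ a = 1 := by decide
  rcases this (par i + par j) with h | h <;> simp [comp, h]

theorem sum_zmod_two {A : Type*} [AddCommMonoid A] (f : ZMod 2 → A) :
    ∑ e : ZMod 2, f e = f 0 + f 1 := Fin.sum_univ_two f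

variable [DecidableEq I]

theorem comp_zero_one : comp par 0 (1 : Matrix I I ℂ) = 1 := by
  ext i j
  by_cases h : i = j
  · subst h
    simp [comp, CharTwo.add_self_eq_zero]
  · simp [comp, Matrix.one_apply_ne h]

theorem comp_one_one : comp par 1 (1 : Matrix I I ℂ) = 0 := by
  ext i j
  by_cases h : i = j
  · subst h
    simp [comp, CharTwo.add_self_eq_zero]
  · simp [comp, Matrix.one_apply_ne h]

variable [Fintype I]

/-- The superbracket `[X, Y] = X Y - (-1)^{|X||Y|} Y X`, extended bilinearly from homogeneous
matrices to all matrices. -/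
def glBracket : Matrix I I ℂ →ₗ[ℂ] Matrix I I ℂ →ₗ[ℂ] Matrix I I ℂ :=
  LinearMap.mk₂ ℂ
    (fun X Y => X * Y -
      ∑ e : ZMod 2, ∑ f : ZMod 2, (-1 : ℂ) ^ (e * f).val • (comp par f Y * comp par e X))
    (by
      intro X X' Y
      simp only [map_add, add_mul, mul_add, smul_add, Finset.sum_add_distrib]
      abel)
    (by
      intro c X Y
      simp only [map_smul, smul_mul_assoc, mul_smul_comm, smul_sub, Finset.smul_sum]
      simp only [smul_comm c])
    (by
      intro X Y Y'
      simp only [map_add, add_mul, mul_add, smul_add, Finset.sum_add_distrib]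
      abel)
    (by
      intro c X Y
      simp only [map_smul, smul_mul_assoc, mul_smul_comm, smul_sub, Finset.smul_sum]
      simp only [smul_comm c])

theorem glBracket_apply (X Y : Matrix I I ℂ) :
    glBracket par X Y = X * Y -
      ∑ e : ZMod 2, ∑ f : ZMod 2, (-1 : ℂ) ^ (e * f).val • (comp par f Y * comp par e X) := rfl

theorem glBracket_one_left (Y : Matrix I I ℂ) : glBracket par 1 Y = 0 := by
  rw [glBracket_apply]
  simp only [sum_zmod_two, comp_zero_one, comp_one_one]
  simp [comp_add_comp]

theorem glBracket_one_right (X : Matrix I I ℂ) : glBracket par X 1 = 0 := by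
  rw [glBracket_apply]
  simp only [sum_zmod_two, comp_zero_one, comp_one_one]
  simp [comp_add_comp]

variable (I) in
/-- The line of scalar matrices, which is central for the superbracket. -/
def scalars : Submodule ℂ (Matrix I I ℂ) := Submodule.span ℂ {1}

variable (I) in
/-- Square matrices modulo scalar matrices. -/
abbrev PGL : Type := Matrix I I ℂ ⧸ scalars I

/-- The superbracket induced on matrices modulo scalars. -/
def pglBracket : PGL I →ₗ[ℂ] PGL I →ₗ[ℂ] PGL I :=
  (scalars I).liftQ
    ((scalars I).liftQ ((glBracket par).compr₂ (scalars I).mkQ).flip (by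
      refine (Submodule.span_singleton_le_iff_mem _ _).2 (LinearMap.mem_ker.2 ?_)
      ext X
      simp [glBracket_one_right])).flip (by
    refine (Submodule.span_singleton_le_iff_mem _ _).2 (LinearMap.mem_ker.2 ?_)
    refine LinearMap.ext fun y => ?_
    obtain ⟨Y, rfl⟩ := (scalars I).mkQ_surjective y
    exact congrArg (scalars I).mkQ (glBracket_one_left par Y))

theorem pglBracket_mk (X Y : Matrix I I ℂ) :
    pglBracket par ((scalars I).mkQ X) ((scalars I).mkQ Y) = (scalars I).mkQ (glBracket par X Y) :=
  rfl

/-- Elements of parity `e` modulo scalars. -/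
def pglPart (e : ZMod 2) : Submodule ℂ (PGL I) := (homog par e).map (scalars I).mkQ

/-- Loops `∑ x_k t^k` with coefficients in matrices modulo scalars. -/
abbrev Loop (I : Type) [Fintype I] [DecidableEq I] : Type := ℤ →₀ PGL I

/-- The bracket `[x t^p, y t^q] = [x, y] t^{p+q}`. -/
def loopBracket (f g : Loop I) : Loop I :=
  f.sum fun p x => g.sum fun q y => Finsupp.single (p + q) (pglBracket par x y)

/-- Loops of parity `e` (the variable `t` is even). -/
def loopPart (e : ZMod 2) : Submodule ℂ (Loop I) where
  carrier := {f | ∀ k, f k ∈ pglPart par e}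
  zero_mem' := by
    intro k
    exact Submodule.zero_mem _
  add_mem' := by
    intro f g hf hg k
    exact Submodule.add_mem _ (hf k) (hg k)
  smul_mem' := by
    intro c f hf k
    exact Submodule.smul_mem _ c (hf k)

/-- The supertrace: trace of the even diagonal block minus trace of the odd one. -/
def strace : Matrix I I ℂ →ₗ[ℂ] ℂ where
  toFun X := ∑ i, (-1 : ℂ) ^ (par i).val * X i i
  map_add' X Y := by simp [mul_add, Finset.sum_add_distrib]
  map_smul' c X := by
    simp only [Matrix.smul_apply, smul_eq_mul, RingHom.id_apply, Finset.mul_sum]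
    exact Finset.sum_congr rfl fun i _ => by ring

/-- The supertranspose `(A, B; C, D) ↦ (Aᵀ, Cᵀ; -Bᵀ, Dᵀ)`. -/
def superTranspose (X : Matrix I I ℂ) : Matrix I I ℂ :=
  Matrix.of fun i j => (-1 : ℂ) ^ (par i * (par i + par j)).val * X j i

/-- The map `X ↦ -B⁻¹ X^{st} B` for a matrix `B` with `B⁻¹ = Bᵀ`. -/
def negAdjoint (B : Matrix I I ℂ) : Matrix I I ℂ →ₗ[ℂ] Matrix I I ℂ where
  toFun X := -(B.transpose * superTranspose par X * B)
  map_add' X Y := by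
    have : superTranspose par (X + Y) = superTranspose par X + superTranspose par Y := by
      ext i j
      simp [superTranspose, mul_add]
    rw [this, mul_add, add_mul, neg_add]
  map_smul' c X := by
    have : superTranspose par (c • X) = c • superTranspose par X := by
      ext i j
      simp [superTranspose, mul_left_comm]
    simp [this]

end LinearSuper

/-! ### The four families of twisted affine Lie superalgebras -/

/-- Types `A(2m,2n-1)^(2)`, `A(2m-1,2n-1)^(2)`, `A(2m,2n)^(4)` and `D(m+1,n)^(2)`. -/
inductive AffineType : Type
  | evenOdd (m n : ℕ) (hn : n ≠ 0)
  | oddOdd (m n : ℕ) (hm : m ≠ 0) (hn : n ≠ 0) (h : (m, n) ≠ (1, 1))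
  | evenEven (m n : ℕ) (h : (m, n) ≠ (0, 0))
  | ortho (m n : ℕ) (hn : n ≠ 0)

/-- The order of the automorphism. -/
def AffineType.order : AffineType → ℕ
  | .evenOdd _ _ _ => 2
  | .oddOdd _ _ _ _ _ => 2
  | .evenEven _ _ _ => 4
  | .ortho _ _ _ => 2

/-- Index set of the supermatrices of size `(2p+a | 2q+b)`: `p` hyperbolic pairs and `a` further
indices in the even block, `q` symplectic pairs and `b` further indices in the odd block. -/
abbrev Idx (p a q b : ℕ) : Type := (Fin p ⊕ Fin p ⊕ Fin a) ⊕ (Fin q ⊕ Fin q ⊕ Fin b)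

/-- Parity of an index. -/
def parity (p a q b : ℕ) : Idx p a q b → ZMod 2 := Sum.elim (fun _ => 0) (fun _ => 1)

/-- The involution exchanging the two indices of a pair and fixing the further indices. -/
def bar (p a q b : ℕ) : Idx p a q b → Idx p a q b
  | .inl (.inl i) => .inl (.inr (.inl i))
  | .inl (.inr (.inl i)) => .inl (.inl i)
  | .inl (.inr (.inr i)) => .inl (.inr (.inr i))
  | .inr (.inl i) => .inr (.inr (.inl i))
  | .inr (.inr (.inl i)) => .inr (.inl i)
  | .inr (.inr (.inr i)) => .inr (.inr (.inr i))

/-- The sign `-1` at the second index of a symplectic pair, and `1` elsewhere. -/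
def formSign (p a q b : ℕ) : Idx p a q b → ℂ
  | .inr (.inr (.inl _)) => -1
  | _ => 1

/-- The matrix `B` of the even bilinear form with `B(i, bar i) = formSign i`, that is
`B = (0, 1, 0; 1, 0, 0; 0, 0, 1)` (symmetric) on the even block and
`B = (0, 1, 0; -1, 0, 0; 0, 0, 1)` on the odd block, in blocks of sizes `p, p, a` and `q, q, b`. -/
def formMatrix (p a q b : ℕ) : Matrix (Idx p a q b) (Idx p a q b) ℂ :=
  Matrix.of fun i j => if j = bar p a q b i then formSign p a q b i else 0

/-- The map `X ↦ -B⁻¹ X^{st} B` of the general linear Lie superalgebra. -/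
def minusAdjoint (p a q b : ℕ) :
    Matrix (Idx p a q b) (Idx p a q b) ℂ →ₗ[ℂ] Matrix (Idx p a q b) (Idx p a q b) ℂ :=
  negAdjoint (parity p a q b) (formMatrix p a q b)

theorem formMatrix_transpose_mul (p a q b : ℕ) :
    (formMatrix p a q b).transpose * formMatrix p a q b = 1 := by
  have hbar : ∀ i, bar p a q b (bar p a q b i) = i := by
    rintro ((i | i | i) | (i | i | i)) <;> rfl
  have hsgn : ∀ i, formSign p a q b i * formSign p a q b i = 1 := by
    rintro ((i | i | i) | (i | i | i)) <;> simp [formSign]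
  ext i j
  rw [Matrix.mul_apply, Finset.sum_eq_single (bar p a q b i)]
  · by_cases hij : i = j
    · subst hij
      simp [formMatrix, hbar, hsgn]
    · simp [formMatrix, hbar, hij, Ne.symm hij]
  · intro k _ hk
    have : i ≠ bar p a q b k := fun h => hk (by rw [h, hbar])
    simp [formMatrix, this]
  · intro h
    exact absurd (Finset.mem_univ _) h

theorem minusAdjoint_one (p a q b : ℕ) : minusAdjoint p a q b 1 = -1 := by
  have h : superTranspose (parity p a q b) (1 : Matrix (Idx p a q b) (Idx p a q b) ℂ) = 1 := by
    ext i j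
    by_cases hij : i = j
    · subst hij
      simp [superTranspose, CharTwo.add_self_eq_zero]
    · simp [superTranspose, Matrix.one_apply_ne hij, Matrix.one_apply_ne (Ne.symm hij)]
  change -((formMatrix p a q b).transpose * superTranspose (parity p a q b) 1 *
    formMatrix p a q b) = -1
  rw [h, mul_one, formMatrix_transpose_mul]

/-- The transposition of the two isotropic basis vectors of the first hyperbolic pair. -/
def swapFirst (p a q b : ℕ) : Equiv.Perm (Idx (p + 1) a q b) :=
  Equiv.swap (Sum.inl (Sum.inl 0)) (Sum.inl (Sum.inr (Sum.inl 0)))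

/-- Conjugation by the permutation matrix of `swapFirst`, a reflection. -/
def conjSwap (p a q b : ℕ) : Matrix (Idx (p + 1) a q b) (Idx (p + 1) a q b) ℂ →ₗ[ℂ]
    Matrix (Idx (p + 1) a q b) (Idx (p + 1) a q b) ℂ where
  toFun X := X.submatrix (swapFirst p a q b) (swapFirst p a q b)
  map_add' _ _ := rfl
  map_smul' _ _ := rfl

namespace AffineType

/-- Number of hyperbolic pairs. -/
def p : AffineType → ℕ
  | .evenOdd m _ _ => m
  | .oddOdd m _ _ _ _ => m
  | .evenEven m _ _ => m
  | .ortho m _ _ => m + 1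

/-- Number of further even indices. -/
def a : AffineType → ℕ
  | .evenOdd _ _ _ => 1
  | .oddOdd _ _ _ _ _ => 0
  | .evenEven _ _ _ => 1
  | .ortho _ _ _ => 0

/-- Number of symplectic pairs. -/
def q : AffineType → ℕ
  | .evenOdd _ n _ => n
  | .oddOdd _ n _ _ _ => n
  | .evenEven _ n _ => n
  | .ortho _ n _ => n

/-- Number of further odd indices. -/
def b : AffineType → ℕ
  | .evenOdd _ _ _ => 0
  | .oddOdd _ _ _ _ _ => 0
  | .evenEven _ _ _ => 1
  | .ortho _ _ _ => 0

/-- The indices of the supermatrices. -/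
abbrev Index (X : AffineType) : Type := Idx X.p X.a X.q X.b

/-- The parity of an index. -/
abbrev par (X : AffineType) : X.Index → ZMod 2 := parity X.p X.a X.q X.b

/-- The automorphism `σ` on matrices: `X ↦ -B⁻¹ X^{st} B` in the three families of type `A`, and
conjugation by a reflection of the even part in type `D(m+1,n)`. -/
def sigmaMatrix : (X : AffineType) →
    (Matrix X.Index X.Index ℂ →ₗ[ℂ] Matrix X.Index X.Index ℂ)
  | .evenOdd m n _ => minusAdjoint m 1 n 0
  | .oddOdd m n _ _ _ => minusAdjoint m 0 n 0
  | .evenEven m n _ => minusAdjoint m 1 n 1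
  | .ortho m n _ => conjSwap m 0 n 0

theorem sigmaMatrix_one_mem (X : AffineType) : X.sigmaMatrix 1 ∈ scalars X.Index := by
  have key : ∀ p a q b : ℕ, minusAdjoint p a q b 1 ∈ scalars (Idx p a q b) := fun p a q b => by
    rw [minusAdjoint_one]
    exact Submodule.neg_mem _ (Submodule.mem_span_singleton_self _)
  cases X with
  | evenOdd m n hn => exact key m 1 n 0
  | oddOdd m n hm hn h => exact key m 0 n 0
  | evenEven m n h => exact key m 1 n 1
  | ortho m n hn =>
    have h1 : conjSwap m 0 n 0 1 = 1 :=
      Matrix.submatrix_one_equiv (swapFirst m 0 n 0)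
    have h2 : conjSwap m 0 n 0 1 ∈ scalars (Idx (m + 1) 0 n 0) := by
      rw [h1]
      exact Submodule.mem_span_singleton_self _
    exact h2

/-- The automorphism `σ` on matrices modulo scalars. -/
def sigma (X : AffineType) : PGL X.Index →ₗ[ℂ] PGL X.Index :=
  (scalars X.Index).mapQ (scalars X.Index) X.sigmaMatrix
    ((Submodule.span_singleton_le_iff_mem _ _).2 X.sigmaMatrix_one_mem)

/-- The matrix Lie superalgebra covering `𝒯`: `sl` (supertrace zero) in the three families of type
`A`, and the orthosymplectic `osp(2m+2|2n) = {X | X^{st} B + B X = 0}` in type `D(m+1,n)`. -/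
def matrixAlg : (X : AffineType) → Submodule ℂ (Matrix X.Index X.Index ℂ)
  | .evenOdd m n _ => LinearMap.ker (strace (parity m 1 n 0))
  | .oddOdd m n _ _ _ => LinearMap.ker (strace (parity m 0 n 0))
  | .evenEven m n _ => LinearMap.ker (strace (parity m 1 n 1))
  | .ortho m n _ => LinearMap.eqLocus (minusAdjoint (m + 1) 0 n 0) LinearMap.id

/-- The basic classical simple Lie superalgebra `𝒯`: the matrix Lie superalgebra modulo the scalar
matrices that it contains. (It contains nonzero ones only for `sl(N|N)`.) -/
def alg (X : AffineType) : Submodule ℂ (PGL X.Index) :=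
  X.matrixAlg.map (scalars X.Index).mkQ

/-- The fixed points `𝔥` of `σ` on the standard (diagonal) Cartan subalgebra of `𝒯`. -/
def cartan (X : AffineType) : Submodule ℂ (PGL X.Index) :=
  X.alg ⊓ (LinearMap.range (Matrix.diagonalLinearMap X.Index ℂ ℂ)).map (scalars X.Index).mkQ ⊓
    LinearMap.eqLocus X.sigma LinearMap.id

/-- The dual space `𝔥^*`. -/
abbrev Weight (X : AffineType) : Type := Module.Dual ℂ X.cartan

/-- `[k]𝒯 = {x ∈ 𝒯 | σ(x) = ζ^k x}`. -/
def eigen (X : AffineType) (ζ : ℂ) (k : ℤ) : Submodule ℂ (PGL X.Index) :=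
  X.alg ⊓ LinearMap.eqLocus X.sigma (ζ ^ k • LinearMap.id)

/-- The `𝔥`-weight space `[k]𝒯^(α)` of `[k]𝒯`. -/
def eigenWeight (X : AffineType) (ζ : ℂ) (α : X.Weight) (k : ℤ) : Submodule ℂ (PGL X.Index) :=
  X.eigen ζ k ⊓ ⨅ h : X.cartan, LinearMap.eqLocus (pglBracket X.par h) (α h • LinearMap.id)

/-- The centerless core `⨁_k [k]𝒯 ⊗ t^k`, with bracket `loopBracket`. -/
def centerlessCore (X : AffineType) (ζ : ℂ) : Submodule ℂ (Loop X.Index) :=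
  ⨆ k : ℤ, (X.eigen ζ k).map (Finsupp.lsingle k)

/-- The pair `(α, k)` stands for `α + kδ`. -/
abbrev RootLattice (X : AffineType) : Type := X.Weight × ℤ

/-- The space `[k]𝒯^(α) ⊗ t^k`. For `α + kδ ≠ 0` it is the root space for `α + kδ`, and for
`α + kδ = 0` it is `𝔥`. -/
def rootSpace (X : AffineType) (ζ : ℂ) (α : X.RootLattice) : Submodule ℂ (Loop X.Index) :=
  (X.eigenWeight ζ α.1 α.2).map (Finsupp.lsingle α.2)

/-- The root system `R`. -/
def roots (X : AffineType) (ζ : ℂ) : Set X.RootLattice :=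
  {α | X.rootSpace ζ α ≠ ⊥}

/-- The set `R₀` of roots whose root space meets the even part nontrivially. -/
def evenRoots (X : AffineType) (ζ : ℂ) : Set X.RootLattice :=
  {α | X.rootSpace ζ α ⊓ loopPart X.par 0 ≠ ⊥}

/-- `Ṡ`, the set of all `α̇` with `α̇ + kδ ∈ S` for some integer `k`. -/
def dotSet (X : AffineType) (S : Set X.RootLattice) : Set X.Weight :=
  {α | ∃ k : ℤ, (α, k) ∈ S}

/-- The subspace `F(S)_cc = 𝔥 + ∑_{0 ≠ α ∈ S} L^α + ∑_k L^{(2k+1)δ}` of the centerless core. -/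
def subalg (X : AffineType) (ζ : ℂ) (S : Set X.RootLattice) : Submodule ℂ (Loop X.Index) :=
  X.cartan.map (Finsupp.lsingle 0) ⊔ (⨆ α ∈ S \ {0}, X.rootSpace ζ α) ⊔
    ⨆ k : ℤ, X.rootSpace ζ (0, 2 * k + 1)

theorem subalg_le_centerlessCore (X : AffineType) (ζ : ℂ) (S : Set X.RootLattice) :
    X.subalg ζ S ≤ X.centerlessCore ζ := by
  have key : ∀ α : X.RootLattice, X.rootSpace ζ α ≤ X.centerlessCore ζ := fun α =>
    le_trans (Submodule.map_mono inf_le_left)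
      (le_iSup (fun k : ℤ => (X.eigen ζ k).map (Finsupp.lsingle k)) α.2)
  refine sup_le (sup_le ?_ (iSup₂_le fun α _ => key α)) (iSup_le fun k => key _)
  refine le_trans (Submodule.map_mono ?_)
    (le_iSup (fun k : ℤ => (X.eigen ζ k).map (Finsupp.lsingle k)) 0)
  intro x hx
  refine ⟨hx.1.1, ?_⟩
  have h2 : X.sigma x = x := hx.2
  simp [h2]

/-- An element of `𝔥`, as an element of `F(S)_cc`. -/
def cartanElt (X : AffineType) (ζ : ℂ) (S : Set X.RootLattice) (h : X.cartan) : X.subalg ζ S :=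
  ⟨Finsupp.single 0 (h : PGL X.Index),
    Submodule.mem_sup_left (Submodule.mem_sup_left ⟨_, h.2, rfl⟩)⟩

end AffineType

/-! ### Modules -/

/-- A supermodule over a (bracket-closed) space `F` of loops: a `ℤ/2`-graded space with a
parity-preserving action satisfying `[x,y]v = x(yv) - (-1)^{|x||y|} y(xv)`. -/
structure SuperModule (X : AffineType) (F : Submodule ℂ (Loop X.Index))
    (V : Type*) [AddCommGroup V] [Module ℂ V] where
  act : F →ₗ[ℂ] Module.End ℂ V
  part : ZMod 2 → Submodule ℂ V
  isCompl : IsCompl (part 0) (part 1)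
  act_mem : ∀ (i j : ZMod 2) (x : F) (v : V),
    (x : Loop X.Index) ∈ loopPart X.par i → v ∈ part j → act x v ∈ part (i + j)
  act_bracket : ∀ (i j : ZMod 2) (x y z : F) (v : V),
    (x : Loop X.Index) ∈ loopPart X.par i → (y : Loop X.Index) ∈ loopPart X.par j →
    (z : Loop X.Index) = loopBracket X.par x y →
      act z v = act x (act y v) - (-1 : ℂ) ^ (i * j).val • act y (act x v)

namespace SuperModule

variable {X : AffineType} {V : Type*} [AddCommGroup V] [Module ℂ V]

/-- Simplicity: `V ≠ 0` and the only graded submodules are `0` and `V`. -/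
def IsSimple {F : Submodule ℂ (Loop X.Index)} (M : SuperModule X F V) : Prop :=
  Nontrivial V ∧ ∀ W : Submodule ℂ V,
    W = (W ⊓ M.part 0) ⊔ (W ⊓ M.part 1) → (∀ (x : F), ∀ v ∈ W, M.act x v ∈ W) → W = ⊥ ∨ W = ⊤

/-- The element `x` acts locally nilpotently. -/
def LocNilp {F : Submodule ℂ (Loop X.Index)} (M : SuperModule X F V) (x : F) : Prop :=
  ∀ v : V, ∃ n : ℕ, (M.act x ^ n) v = 0

variable {ζ : ℂ} {S : Set X.RootLattice}

/-- The `𝔥`-weight space `V^μ`. -/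
def weightSpace (M : SuperModule X (X.subalg ζ S) V) (μ : X.Weight) : Submodule ℂ V :=
  ⨅ h : X.cartan, LinearMap.eqLocus (M.act (X.cartanElt ζ S h)) (μ h • LinearMap.id)

/-- The support, i.e. the set of weights. -/
def supp (M : SuperModule X (X.subalg ζ S) V) : Set X.Weight :=
  {μ | M.weightSpace μ ≠ ⊥}

/-- `V` is the direct sum of its weight spaces, and these are finite dimensional. -/
def IsFiniteWeight (M : SuperModule X (X.subalg ζ S) V) : Prop :=
  iSupIndep M.weightSpace ∧ ⨆ μ, M.weightSpace μ = ⊤ ∧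
    ∀ μ, FiniteDimensional ℂ (M.weightSpace μ)

end SuperModule

end TwistedAffine

end

/-! Let `x` be a root vector in `S` over `α ≠ 0`. If some string `λ + sα` is finite, a power of `x`
kills a nonzero vector of weight `λ`. The vectors killed by powers of `x` form a graded subspace,
because `x` is even. This subspace is stable under the whole algebra, because `ad x` is nilpotent on
each root vector: the weights `nα + β` would otherwise give infinitely many eigenvalues on a finite
dimensional space. Simplicity makes the subspace all of `V` (`locNilp_of_pow_act_eq_zero`).

Conversely, suppose that `x` acts locally nilpotently. The conjugate transpose of a matrix
representing `x` completes it, after scaling, to an `sl₂`-triple whose third member lies in `𝔥`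
(`exists_sl2Triple`). An infinite string would contain infinitely many singular vectors for this
`sl₂`. Lowering them to one fixed weight space would give the Casimir operator infinitely many
eigenvalues there, contradicting finite dimensionality (`finite_weights_of_sl2`). This argument uses
neither simplicity nor a particular `λ`, so one nilpotent root vector bounds all strings.

Two facts about the matrices are needed. The root space of an even root off `ℤδ` is purely even
(`exists_even_rep`), and the zero weight space of the fixed points of `σ` is exactly `𝔥`
(`eigenWeight_zero_le_cartan`). Both follow from exhibiting one integral diagonal element of `𝔥`
that separates enough matrix entries. -/

noncomputable section

namespace TwistedAffine

/-! ### Supermatrices: parity, supertrace, diagonal parts. -/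

section LinearSuper

variable {I : Type} (par : I → ZMod 2)

theorem comp_apply (e : ZMod 2) (X : Matrix I I ℂ) (i j : I) :
    comp par e X i j = if par i + par j = e then X i j else 0 := rfl

theorem comp_mem_homog (e : ZMod 2) (X : Matrix I I ℂ) : comp par e X ∈ homog par e := by
  intro i j h
  simp [comp_apply, h]

theorem comp_eq_self {e : ZMod 2} {X : Matrix I I ℂ} (h : X ∈ homog par e) :
    comp par e X = X := by
  ext i j
  by_cases hij : par i + par j = e
  · simp [comp_apply, hij]
  · simp [comp_apply, hij, h i j hij]

theorem comp_eq_zero {e f : ZMod 2} (hef : e ≠ f) {X : Matrix I I ℂ} (h : X ∈ homog par e) :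
    comp par f X = 0 := by
  ext i j
  by_cases hij : par i + par j = f
  · simp [comp_apply, hij, h i j (by rw [hij]; exact hef.symm)]
  · simp [comp_apply, hij]

theorem par_eq_of_even {X : Matrix I I ℂ} (h : X ∈ homog par 0) {i j : I} (hij : X i j ≠ 0) :
    par i = par j := by
  by_contra hne
  exact hij (h i j fun h0 => hne (by
    have := congrArg (· + par j) h0
    simpa [add_assoc, CharTwo.add_self_eq_zero] using this))

theorem homog_conjTranspose {e : ZMod 2} {X : Matrix I I ℂ} (h : X ∈ homog par e) :
    X.conjTranspose ∈ homog par e := by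
  intro i j hij
  simp [h j i (by rwa [add_comm])]

section

variable [Fintype I]

theorem mul_mem_homog {e f : ZMod 2} {X Y : Matrix I I ℂ} (hX : X ∈ homog par e)
    (hY : Y ∈ homog par f) : X * Y ∈ homog par (e + f) := by
  intro i j hij
  rw [Matrix.mul_apply]
  refine Finset.sum_eq_zero fun k _ => ?_
  by_contra hne
  refine hij ?_
  have h1 : par i + par k = e := by
    by_contra h
    exact left_ne_zero_of_mul hne (hX i k h)
  have h2 : par k + par j = f := by
    by_contra h
    exact right_ne_zero_of_mul hne (hY k j h)
  rw [← h1, ← h2, add_assoc, ← add_assoc (par k), CharTwo.add_self_eq_zero, zero_add]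

theorem commutator_mem_homog {e : ZMod 2} {X Y : Matrix I I ℂ} (hX : X ∈ homog par 0)
    (hY : Y ∈ homog par e) : X * Y - Y * X ∈ homog par e := by
  have h1 := mul_mem_homog par hX hY
  have h2 := mul_mem_homog par hY hX
  rw [zero_add] at h1
  rw [add_zero] at h2
  exact Submodule.sub_mem _ h1 h2

theorem strace_apply (X : Matrix I I ℂ) :
    strace par X = ∑ i, (-1 : ℂ) ^ (par i).val * X i i := rfl

/-- A nonzero entry of an even matrix joins indices of equal parity, so the supertrace signs agree
after the two summations are exchanged. -/
theorem strace_commutator {X : Matrix I I ℂ} (h : X ∈ homog par 0) (Y : Matrix I I ℂ) :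
    strace par (X * Y - Y * X) = 0 := by
  rw [map_sub, sub_eq_zero]
  simp only [strace_apply, Matrix.mul_apply, Finset.mul_sum]
  rw [Finset.sum_comm]
  refine Finset.sum_congr rfl fun i _ => Finset.sum_congr rfl fun j _ => ?_
  by_cases hX : X j i = 0
  · simp [hX]
  · rw [par_eq_of_even par h hX]
    ring

theorem strace_comp (e : ZMod 2) {X : Matrix I I ℂ} (h : strace par X = 0) :
    strace par (comp par e X) = 0 := by
  by_cases he : (0 : ZMod 2) = e
  · rw [← h]
    simp [strace_apply, comp_apply, CharTwo.add_self_eq_zero, he]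
  · simp [strace_apply, comp_apply, CharTwo.add_self_eq_zero, he]

theorem strace_conjTranspose (X : Matrix I I ℂ) :
    strace par X.conjTranspose = star (strace par X) := by
  simp [strace_apply]

end

variable [DecidableEq I]

/-- The matrix with its diagonal replaced by zero. -/
def offDiag : Matrix I I ℂ →ₗ[ℂ] Matrix I I ℂ where
  toFun X := Matrix.of fun i j => if i = j then 0 else X i j
  map_add' X Y := by
    ext i j
    by_cases h : i = j <;> simp [h]
  map_smul' c X := by
    ext i j
    by_cases h : i = j <;> simp [h]

theorem offDiag_apply (X : Matrix I I ℂ) (i j : I) :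
    offDiag X i j = if i = j then 0 else X i j := rfl

theorem offDiag_one : offDiag (1 : Matrix I I ℂ) = 0 := by
  ext i j
  by_cases h : i = j <;> simp [offDiag_apply, h]

theorem offDiag_add_diagonal (X : Matrix I I ℂ) :
    offDiag X + Matrix.diagonal (fun i => X i i) = X := by
  ext i j
  by_cases h : i = j
  · subst h
    simp [offDiag_apply]
  · simp [offDiag_apply, h]

theorem offDiag_mem_homog {e : ZMod 2} {X : Matrix I I ℂ} (h : X ∈ homog par e) :
    offDiag X ∈ homog par e := by
  intro i j hij
  simp [offDiag_apply, h i j hij]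

theorem diagonal_mem_homog (d : I → ℂ) : Matrix.diagonal d ∈ homog par 0 := by
  intro i j hij
  refine Matrix.diagonal_apply_ne _ fun h => hij ?_
  rw [h, CharTwo.add_self_eq_zero]

variable [Fintype I]

/-- No sign arises when one argument is even. Later brackets all have an even left argument, so
ordinary commutators suffice. -/
theorem glBracket_of_even {X : Matrix I I ℂ} (h : X ∈ homog par 0) (Y : Matrix I I ℂ) :
    glBracket par X Y = X * Y - Y * X := by
  rw [glBracket_apply]
  simp only [sum_zmod_two, comp_eq_self par h, comp_eq_zero par zero_ne_one h]
  simp [← add_mul, comp_add_comp]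

theorem strace_offDiag (X : Matrix I I ℂ) : strace par (offDiag X) = 0 := by
  simp [strace_apply, offDiag_apply]

end LinearSuper

/-! ### The map `X ↦ -B⁻¹ X^{st} B` and separating integral weights. -/

section Form

variable {p a q b : ℕ}

theorem bar_bar (i : Idx p a q b) : bar p a q b (bar p a q b i) = i := by
  rcases i with (i | i | i) | (i | i | i) <;> rfl

theorem parity_bar (i : Idx p a q b) : parity p a q b (bar p a q b i) = parity p a q b i := by
  rcases i with (i | i | i) | (i | i | i) <;> rfl

theorem bar_injective : Function.Injective (bar p a q b) :=
  Function.LeftInverse.injective bar_bar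

theorem formSign_mul_self (i : Idx p a q b) : formSign p a q b i * formSign p a q b i = 1 := by
  rcases i with (i | i | i) | (i | i | i) <;> simp [formSign]

theorem star_formSign (i : Idx p a q b) : star (formSign p a q b i) = formSign p a q b i := by
  rcases i with (i | i | i) | (i | i | i) <;> simp [formSign]

/-- Since `B` is monomial, the map only permutes entries with signs; later properties reduce to sign
identities. -/
theorem minusAdjoint_apply (X : Matrix (Idx p a q b) (Idx p a q b) ℂ) (i j : Idx p a q b) :
    minusAdjoint p a q b X i j =
      -(formSign p a q b (bar p a q b i) * formSign p a q b (bar p a q b j) *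
        (-1 : ℂ) ^ (parity p a q b i * (parity p a q b i + parity p a q b j)).val) *
        X (bar p a q b j) (bar p a q b i) := by
  have h : minusAdjoint p a q b X i j = -(((formMatrix p a q b).transpose *
    superTranspose (parity p a q b) X * formMatrix p a q b) i j) := rfl
  rw [h, Matrix.mul_apply, Finset.sum_eq_single (bar p a q b j), Matrix.mul_apply,
    Finset.sum_eq_single (bar p a q b i)]
  · simp only [formMatrix, Matrix.transpose_apply, Matrix.of_apply, bar_bar, if_true,
      superTranspose, parity_bar]
    ring
  · intro k _ hk
    have : i ≠ bar p a q b k := fun h => hk (by rw [h, bar_bar])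
    simp [formMatrix, this]
  · intro h
    exact absurd (Finset.mem_univ _) h
  · intro k _ hk
    have : j ≠ bar p a q b k := fun h => hk (by rw [h, bar_bar])
    simp [formMatrix, this]
  · intro h
    exact absurd (Finset.mem_univ _) h

theorem minusAdjoint_apply_of_par_eq (X : Matrix (Idx p a q b) (Idx p a q b) ℂ)
    {i j : Idx p a q b} (h : parity p a q b i = parity p a q b j) :
    minusAdjoint p a q b X i j =
      -(formSign p a q b (bar p a q b i) * formSign p a q b (bar p a q b j)) *
        X (bar p a q b j) (bar p a q b i) := by
  rw [minusAdjoint_apply, h, CharTwo.add_self_eq_zero]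
  simp

theorem minusAdjoint_comp (e : ZMod 2) (X : Matrix (Idx p a q b) (Idx p a q b) ℂ) :
    minusAdjoint p a q b (comp (parity p a q b) e X) =
      comp (parity p a q b) e (minusAdjoint p a q b X) := by
  ext i j
  simp only [minusAdjoint_apply, comp_apply, parity_bar]
  rw [add_comm (parity p a q b j)]
  by_cases h : parity p a q b i + parity p a q b j = e <;> simp [h]

theorem minusAdjoint_mem_homog {X : Matrix (Idx p a q b) (Idx p a q b) ℂ} {e : ZMod 2}
    (h : X ∈ homog (parity p a q b) e) : minusAdjoint p a q b X ∈ homog (parity p a q b) e := by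
  rw [← comp_eq_self _ h, minusAdjoint_comp]
  exact comp_mem_homog _ _ _

theorem minusAdjoint_offDiag (X : Matrix (Idx p a q b) (Idx p a q b) ℂ) :
    minusAdjoint p a q b (offDiag X) = offDiag (minusAdjoint p a q b X) := by
  ext i j
  simp only [minusAdjoint_apply, offDiag_apply, bar_injective.eq_iff, eq_comm (a := j)]
  by_cases h : i = j <;> simp [h]

/-- Within a parity block the sign is real and symmetric in the two indices, which is why evenness
is required. -/
theorem minusAdjoint_conjTranspose {X : Matrix (Idx p a q b) (Idx p a q b) ℂ}
    (h : X ∈ homog (parity p a q b) 0) :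
    minusAdjoint p a q b X.conjTranspose = (minusAdjoint p a q b X).conjTranspose := by
  ext i j
  by_cases hij : parity p a q b i = parity p a q b j
  · rw [Matrix.conjTranspose_apply, minusAdjoint_apply_of_par_eq _ hij,
      minusAdjoint_apply_of_par_eq _ hij.symm, Matrix.conjTranspose_apply]
    simp only [star_mul', star_neg, star_formSign]
    ring
  · have h0 : ∀ Z ∈ homog (parity p a q b) 0, Z i j = 0 := fun Z hZ => by
      by_contra hne
      exact hij (par_eq_of_even _ hZ hne)
    rw [h0 _ (minusAdjoint_mem_homog (homog_conjTranspose _ h)),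
      h0 _ (homog_conjTranspose _ (minusAdjoint_mem_homog h))]

/-- Reindex the product by `bar`. Terms survive only where the entry of `X` preserves parity, so no
supertranspose sign remains from `X`. -/
theorem minusAdjoint_mul_of_even_left {X : Matrix (Idx p a q b) (Idx p a q b) ℂ}
    (h : X ∈ homog (parity p a q b) 0) (Y : Matrix (Idx p a q b) (Idx p a q b) ℂ) :
    minusAdjoint p a q b (X * Y) = -(minusAdjoint p a q b Y * minusAdjoint p a q b X) := by
  ext i j
  rw [minusAdjoint_apply, Matrix.neg_apply, Matrix.mul_apply, Matrix.mul_apply, Finset.mul_sum,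
    ← Finset.sum_neg_distrib]
  refine (Fintype.sum_bijective _ (Function.Involutive.bijective bar_bar) _ _ fun k => ?_).symm
  simp only [minusAdjoint_apply]
  by_cases hX : X (bar p a q b j) (bar p a q b k) = 0
  · simp [hX]
  · have hp := par_eq_of_even _ h hX
    simp only [parity_bar] at hp
    rw [hp, CharTwo.add_self_eq_zero]
    simp only [mul_zero, ZMod.val_zero, pow_zero, mul_one]
    linear_combination (-(formSign p a q b (bar p a q b i) * formSign p a q b (bar p a q b j) *
        (-1 : ℂ) ^ (parity p a q b i * (parity p a q b i + parity p a q b k)).val) *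
        X (bar p a q b j) (bar p a q b k) * Y (bar p a q b k) (bar p a q b i)) *
        formSign_mul_self (bar p a q b k)

theorem minusAdjoint_mul_of_even_right {X : Matrix (Idx p a q b) (Idx p a q b) ℂ}
    (h : X ∈ homog (parity p a q b) 0) (Y : Matrix (Idx p a q b) (Idx p a q b) ℂ) :
    minusAdjoint p a q b (Y * X) = -(minusAdjoint p a q b X * minusAdjoint p a q b Y) := by
  ext i j
  rw [minusAdjoint_apply, Matrix.neg_apply, Matrix.mul_apply, Matrix.mul_apply, Finset.mul_sum,
    ← Finset.sum_neg_distrib]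
  refine (Fintype.sum_bijective _ (Function.Involutive.bijective bar_bar) _ _ fun k => ?_).symm
  simp only [minusAdjoint_apply]
  by_cases hX : X (bar p a q b k) (bar p a q b i) = 0
  · simp [hX]
  · have hp := par_eq_of_even _ h hX
    simp only [parity_bar] at hp
    rw [hp, CharTwo.add_self_eq_zero]
    simp only [mul_zero, ZMod.val_zero, pow_zero, mul_one]
    linear_combination (-(formSign p a q b (bar p a q b i) * formSign p a q b (bar p a q b j) *
        (-1 : ℂ) ^ (parity p a q b i * (parity p a q b i + parity p a q b j)).val) *
        X (bar p a q b k) (bar p a q b i) * Y (bar p a q b j) (bar p a q b k)) *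
        formSign_mul_self (bar p a q b k)

theorem minusAdjoint_commutator {X : Matrix (Idx p a q b) (Idx p a q b) ℂ}
    (h : X ∈ homog (parity p a q b) 0) (Y : Matrix (Idx p a q b) (Idx p a q b) ℂ) :
    minusAdjoint p a q b (X * Y - Y * X) =
      minusAdjoint p a q b X * minusAdjoint p a q b Y -
        minusAdjoint p a q b Y * minusAdjoint p a q b X := by
  rw [map_sub, minusAdjoint_mul_of_even_left h, minusAdjoint_mul_of_even_right h]
  abel

theorem minusAdjoint_diagonal {d : Idx p a q b → ℂ} (hd : ∀ i, d (bar p a q b i) = -d i) :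
    minusAdjoint p a q b (Matrix.diagonal d) = Matrix.diagonal d := by
  ext i j
  by_cases h : i = j
  · subst h
    rw [minusAdjoint_apply_of_par_eq _ rfl, formSign_mul_self]
    simp [hd]
  · rw [minusAdjoint_apply, Matrix.diagonal_apply_ne _ h,
      Matrix.diagonal_apply_ne _ fun hb => h (bar_injective hb).symm, mul_zero]

theorem strace_diagonal {d : Idx p a q b → ℂ} (hd : ∀ i, d (bar p a q b i) = -d i) :
    strace (parity p a q b) (Matrix.diagonal d) = 0 := by
  have h : strace (parity p a q b) (Matrix.diagonal d) =
      -strace (parity p a q b) (Matrix.diagonal d) := by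
    simp only [strace_apply, Matrix.diagonal_apply_eq]
    rw [← Finset.sum_neg_distrib]
    exact Fintype.sum_bijective _ (Function.Involutive.bijective bar_bar) _ _ fun i => by
      rw [hd, parity_bar]
      ring
  exact self_eq_neg.1 h

/-- The sign by which the square of `minusAdjoint` twists an index. -/
def twistSign (p a q b : ℕ) : Idx p a q b → ℤ
  | .inr (.inr (.inr _)) => -1
  | _ => 1

/-- The square is conjugation by a diagonal sign matrix that singles out the further odd indices.
These are the reason for order 4 in type `A(2m,2n)^(4)`. -/
theorem minusAdjoint_minusAdjoint (X : Matrix (Idx p a q b) (Idx p a q b) ℂ)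
    (i j : Idx p a q b) : minusAdjoint p a q b (minusAdjoint p a q b X) i j =
      (twistSign p a q b i * twistSign p a q b j : ℤ) * X i j := by
  simp only [minusAdjoint_apply, bar_bar, parity_bar]
  rcases i with (i | i | i) | (i | i | i) <;> rcases j with (j | j | j) | (j | j | j) <;>
    simp [formSign, bar, parity, twistSign, CharTwo.add_self_eq_zero, ZMod.val_one]

/-- The integral weight that counts the symplectic indices. -/
def oddWeight (p a q b : ℕ) : Idx p a q b → ℤ
  | .inr (.inl _) => 1
  | .inr (.inr (.inl _)) => -1
  | _ => 0

theorem oddWeight_bar (i : Idx p a q b) :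
    oddWeight p a q b (bar p a q b i) = -oddWeight p a q b i := by
  rcases i with (i | i | i) | (i | i | i) <;> rfl

/-- Modulo 2, the parity of an index is its `oddWeight`, plus 1 where `twistSign` is `-1`. Hence the
weight difference and the product of twist signs determine the parity of an entry. -/
theorem parity_add_eq_of_oddWeight {i j k l : Idx p a q b}
    (hw : oddWeight p a q b i - oddWeight p a q b j = oddWeight p a q b k - oddWeight p a q b l)
    (ht : twistSign p a q b i * twistSign p a q b j = twistSign p a q b k * twistSign p a q b l) :
    parity p a q b i + parity p a q b j = parity p a q b k + parity p a q b l := by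
  rcases i with (i | i | i) | (i | i | i) <;> rcases j with (j | j | j) | (j | j | j) <;>
  rcases k with (k | k | k) | (k | k | k) <;> rcases l with (l | l | l) | (l | l | l) <;>
    first
    | rfl
    | (exfalso; revert hw; simp only [oddWeight]; decide)
    | (exfalso; revert ht; simp only [twistSign]; decide)

/-- A weight that separates the indices that belong to pairs, if `c = 1`; if `c = 0`, the first
hyperbolic pair has weight zero. -/
def genericWeight (p a q b c : ℕ) : Idx p a q b → ℤ
  | .inl (.inl i) => i + c
  | .inl (.inr (.inl i)) => -(i + c)
  | .inr (.inl i) => p + 1 + i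
  | .inr (.inr (.inl i)) => -(p + 1 + i)
  | _ => 0

theorem genericWeight_bar (c : ℕ) (i : Idx p a q b) :
    genericWeight p a q b c (bar p a q b i) = -genericWeight p a q b c i := by
  rcases i with (i | i | i) | (i | i | i) <;> simp [genericWeight, bar]

end Form

/-! ### Passage to matrices modulo scalars. -/

section LinearSuper

variable {I : Type} (par : I → ZMod 2) [DecidableEq I]

theorem mkQ_scalars_eq_iff {X Y : Matrix I I ℂ} :
    (scalars I).mkQ X = (scalars I).mkQ Y ↔ ∃ c : ℂ, X = Y + c • 1 := by
  rw [← sub_eq_zero, ← map_sub, Submodule.mkQ_apply, Submodule.Quotient.mk_eq_zero, scalars,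
    Submodule.mem_span_singleton]
  exact exists_congr fun c => by rw [eq_comm, sub_eq_iff_eq_add']

theorem one_mem_homog : (1 : Matrix I I ℂ) ∈ homog par 0 := by
  rw [← comp_zero_one par]
  exact comp_mem_homog _ _ _

theorem mkQ_mem_pglPart_zero {X : Matrix I I ℂ} :
    (scalars I).mkQ X ∈ pglPart par 0 ↔ X ∈ homog par 0 := by
  refine ⟨?_, fun h => ⟨X, h, rfl⟩⟩
  rintro ⟨Y, hY, hYX⟩
  obtain ⟨c, rfl⟩ := mkQ_scalars_eq_iff.1 hYX.symm
  exact Submodule.add_mem _ hY (Submodule.smul_mem _ _ (one_mem_homog par))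

/-- The component of parity `e` modulo scalars. -/
def pglComp (e : ZMod 2) : PGL I →ₗ[ℂ] PGL I :=
  (scalars I).mapQ (scalars I) (comp par e) (by
    refine (Submodule.span_singleton_le_iff_mem _ _).2 ?_
    have : ∀ a : ZMod 2, a = 0 ∨ a = 1 := by decide
    rcases this e with rfl | rfl
    · rw [Submodule.mem_comap, comp_zero_one]
      exact Submodule.mem_span_singleton_self _
    · rw [Submodule.mem_comap, comp_one_one]
      exact Submodule.zero_mem _)

theorem pglComp_mk (e : ZMod 2) (X : Matrix I I ℂ) :
    pglComp par e ((scalars I).mkQ X) = (scalars I).mkQ (comp par e X) := rfl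

theorem pglComp_mem_pglPart (e : ZMod 2) (x : PGL I) : pglComp par e x ∈ pglPart par e := by
  obtain ⟨X, rfl⟩ := (scalars I).mkQ_surjective x
  exact ⟨_, comp_mem_homog par e X, rfl⟩

theorem pglComp_add_pglComp (x : PGL I) : pglComp par 0 x + pglComp par 1 x = x := by
  obtain ⟨X, rfl⟩ := (scalars I).mkQ_surjective x
  rw [pglComp_mk, pglComp_mk, ← map_add, comp_add_comp]

variable [Fintype I]

theorem pglBracket_mk_of_even {X : Matrix I I ℂ} (h : X ∈ homog par 0) (Y : Matrix I I ℂ) :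
    pglBracket par ((scalars I).mkQ X) ((scalars I).mkQ Y) =
      (scalars I).mkQ (X * Y - Y * X) := by
  rw [pglBracket_mk, glBracket_of_even par h]

theorem pglBracket_jacobi {x y : PGL I} (hx : x ∈ pglPart par 0) (hy : y ∈ pglPart par 0)
    (z : PGL I) : pglBracket par x (pglBracket par y z) =
      pglBracket par (pglBracket par x y) z + pglBracket par y (pglBracket par x z) := by
  obtain ⟨X, hX, rfl⟩ := hx
  obtain ⟨Y, hY, rfl⟩ := hy
  obtain ⟨Z, rfl⟩ := (scalars I).mkQ_surjective z
  simp only [SetLike.mem_coe] at hX hY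
  rw [pglBracket_mk_of_even par hY, pglBracket_mk_of_even par hX, pglBracket_mk_of_even par hX,
    pglBracket_mk_of_even par hX, pglBracket_mk_of_even par hY, pglBracket_mk_of_even par
      (commutator_mem_homog par hX hY), ← map_add]
  congr 1
  noncomm_ring

theorem pglBracket_mem_pglPart {e : ZMod 2} {x y : PGL I} (hx : x ∈ pglPart par 0)
    (hy : y ∈ pglPart par e) : pglBracket par x y ∈ pglPart par e := by
  obtain ⟨X, hX, rfl⟩ := hx
  obtain ⟨Y, hY, rfl⟩ := hy
  rw [pglBracket_mk_of_even par hX]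
  exact ⟨_, commutator_mem_homog par hX hY, rfl⟩

theorem comp_commutator_diagonal (e : ZMod 2) (d : I → ℂ) (X : Matrix I I ℂ) :
    comp par e (Matrix.diagonal d * X - X * Matrix.diagonal d) =
      Matrix.diagonal d * comp par e X - comp par e X * Matrix.diagonal d := by
  ext i j
  by_cases h : par i + par j = e <;>
    simp [comp_apply, h]

end LinearSuper

/-- A skew-adjoint off-diagonal matrix without further indices vanishes if it commutes with the
weight that separates all hyperbolic pairs but the first. -/
theorem eq_zero_of_genericWeight_zero {p q : ℕ} {Y : Matrix (Idx p 0 q 0) (Idx p 0 q 0) ℂ}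
    (hY : minusAdjoint p 0 q 0 Y = Y) (hd : ∀ i, Y i i = 0)
    (hw : ∀ i j, genericWeight p 0 q 0 0 i ≠ genericWeight p 0 q 0 0 j → Y i j = 0) : Y = 0 := by
  -- At a position `(i, bar i)` in the even block, skew-adjointness reads `y = -y`.
  have hz : ∀ i j : Idx (p) 0 q 0, bar (p) 0 q 0 i = j →
      parity (p) 0 q 0 i = 0 → Y i j = 0 := by
    rintro i j rfl hp
    have h1 := congrFun (congrFun hY i) (bar (p) 0 q 0 i)
    rw [minusAdjoint_apply_of_par_eq _ (parity_bar i).symm, bar_bar] at h1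
    rcases i with (i | i | i) | (i | i | i)
    all_goals simp [formSign, bar, parity] at h1 hp ⊢
    · exact neg_eq_self.1 h1
    · exact neg_eq_self.1 h1
    · exact i.elim0
  ext i j
  by_contra hne
  have h3 : genericWeight (p) 0 q 0 0 i = genericWeight (p) 0 q 0 0 j := by
    by_contra h
    exact hne (hw i j h)
  have h4 : i ≠ j := fun h => hne (by rw [h, hd]; rfl)
  have h5 : parity (p) 0 q 0 i = 0 → bar (p) 0 q 0 i ≠ j :=
    fun hp hb => hne (hz i j hb hp)
  clear hne hw hz hd hY
  -- Equal weights force `i = j`, except inside the first hyperbolic pair, where `j = bar i` is also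
  -- possible.
  rcases i with (i | i | i) | (i | i | i) <;> rcases j with (j | j | j) | (j | j | j) <;>
    simp only [genericWeight] at h3 <;>
    first
    | exact i.elim0
    | exact j.elim0
    | omega
    | exact h4 (by congr 2; omega)
    | exact h4 (by congr 3; omega)
    | exact h5 rfl (by simp only [bar]; congr 2; omega)
    | exact h5 rfl (by simp only [bar]; congr 3; omega)

/-! ### The reflection used in type `D(m+1,n)`. -/

theorem parity_swapFirst {p a q b : ℕ} (i : Idx (p + 1) a q b) :
    parity (p + 1) a q b (swapFirst p a q b i) = parity (p + 1) a q b i := by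
  unfold swapFirst
  by_cases h1 : i = Sum.inl (Sum.inl 0)
  · subst h1
    simp [parity]
  by_cases h2 : i = Sum.inl (Sum.inr (Sum.inl 0))
  · subst h2
    simp [parity]
  rw [Equiv.swap_apply_of_ne_of_ne h1 h2]

theorem conjSwap_apply {p a q b : ℕ}
    (X : Matrix (Idx (p + 1) a q b) (Idx (p + 1) a q b) ℂ) (i j : Idx (p + 1) a q b) :
    conjSwap p a q b X i j = X (swapFirst p a q b i) (swapFirst p a q b j) := rfl

theorem conjSwap_comp {p a q b : ℕ} (e : ZMod 2)
    (X : Matrix (Idx (p + 1) a q b) (Idx (p + 1) a q b) ℂ) :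
    conjSwap p a q b (comp (parity (p + 1) a q b) e X) =
      comp (parity (p + 1) a q b) e (conjSwap p a q b X) := by
  ext i j
  simp only [conjSwap_apply, comp_apply, parity_swapFirst]

theorem conjSwap_offDiag {p a q b : ℕ}
    (X : Matrix (Idx (p + 1) a q b) (Idx (p + 1) a q b) ℂ) :
    conjSwap p a q b (offDiag X) = offDiag (conjSwap p a q b X) := by
  ext i j
  simp only [conjSwap_apply, offDiag_apply, EmbeddingLike.apply_eq_iff_eq]

theorem conjSwap_commutator {p a q b : ℕ}
    (X Y : Matrix (Idx (p + 1) a q b) (Idx (p + 1) a q b) ℂ) :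
    conjSwap p a q b (X * Y - Y * X) =
      conjSwap p a q b X * conjSwap p a q b Y - conjSwap p a q b Y * conjSwap p a q b X := by
  have h : ∀ X Y : Matrix (Idx (p + 1) a q b) (Idx (p + 1) a q b) ℂ, conjSwap p a q b (X * Y) =
      conjSwap p a q b X * conjSwap p a q b Y := fun X Y =>
    (Matrix.submatrix_mul_equiv X Y _ (swapFirst p a q b) _).symm
  rw [map_sub, h, h]

theorem conjSwap_diagonal {p a q b : ℕ} {d : Idx (p + 1) a q b → ℂ}
    (h1 : d (Sum.inl (Sum.inl 0)) = d (Sum.inl (Sum.inr (Sum.inl 0)))) :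
    conjSwap p a q b (Matrix.diagonal d) = Matrix.diagonal d := by
  have h : ∀ i, d (swapFirst p a q b i) = d i := fun i => by
    unfold swapFirst
    by_cases h2 : i = Sum.inl (Sum.inl 0)
    · rw [h2, Equiv.swap_apply_left, h1]
    by_cases h3 : i = Sum.inl (Sum.inr (Sum.inl 0))
    · rw [h3, Equiv.swap_apply_right, h1]
    rw [Equiv.swap_apply_of_ne_of_ne h2 h3]
  ext i j
  rw [conjSwap_apply]
  by_cases hij : i = j
  · subst hij
    simp [h]
  · rw [Matrix.diagonal_apply_ne _ hij, Matrix.diagonal_apply_ne _ fun hs =>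
      hij ((swapFirst p a q b).injective hs)]

/-! ### The automorphism in the four families, and separating elements of the Cartan subalgebra. -/

namespace AffineType

variable (X : AffineType)

theorem sigmaMatrix_comp (e : ZMod 2) (Y : Matrix X.Index X.Index ℂ) :
    X.sigmaMatrix (comp X.par e Y) = comp X.par e (X.sigmaMatrix Y) := by
  cases X
  · exact minusAdjoint_comp e Y
  · exact minusAdjoint_comp e Y
  · exact minusAdjoint_comp e Y
  · exact conjSwap_comp e Y

variable {X} in
theorem sigmaMatrix_mem_homog {e : ZMod 2} {Y : Matrix X.Index X.Index ℂ}
    (h : Y ∈ homog X.par e) : X.sigmaMatrix Y ∈ homog X.par e := by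
  rw [← comp_eq_self _ h, sigmaMatrix_comp]
  exact comp_mem_homog _ _ _

theorem sigmaMatrix_offDiag (Y : Matrix X.Index X.Index ℂ) :
    X.sigmaMatrix (offDiag Y) = offDiag (X.sigmaMatrix Y) := by
  cases X
  · exact minusAdjoint_offDiag Y
  · exact minusAdjoint_offDiag Y
  · exact minusAdjoint_offDiag Y
  · exact conjSwap_offDiag Y

variable {X}

/-- This compatibility lets the conjugate transpose of an even root vector serve as the opposite
root vector. -/
theorem sigmaMatrix_conjTranspose {Y : Matrix X.Index X.Index ℂ} (h : Y ∈ homog X.par 0) :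
    X.sigmaMatrix Y.conjTranspose = (X.sigmaMatrix Y).conjTranspose := by
  cases X
  · exact minusAdjoint_conjTranspose h
  · exact minusAdjoint_conjTranspose h
  · exact minusAdjoint_conjTranspose h
  · rfl

theorem sigmaMatrix_commutator {Y : Matrix X.Index X.Index ℂ} (h : Y ∈ homog X.par 0)
    (Z : Matrix X.Index X.Index ℂ) : X.sigmaMatrix (Y * Z - Z * Y) =
      X.sigmaMatrix Y * X.sigmaMatrix Z - X.sigmaMatrix Z * X.sigmaMatrix Y := by
  cases X
  · exact minusAdjoint_commutator h Z
  · exact minusAdjoint_commutator h Z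
  · exact minusAdjoint_commutator h Z
  · exact conjSwap_commutator Y Z

theorem comp_mem_matrixAlg (e : ZMod 2) {Y : Matrix X.Index X.Index ℂ} (h : Y ∈ X.matrixAlg) :
    comp X.par e Y ∈ X.matrixAlg := by
  cases X
  · exact strace_comp _ e h
  · exact strace_comp _ e h
  · exact strace_comp _ e h
  · exact (minusAdjoint_comp e Y).trans (congrArg _ h)

theorem offDiag_mem_matrixAlg {Y : Matrix X.Index X.Index ℂ} (h : Y ∈ X.matrixAlg) :
    offDiag Y ∈ X.matrixAlg := by
  cases X
  · exact strace_offDiag _ Y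
  · exact strace_offDiag _ Y
  · exact strace_offDiag _ Y
  · exact (minusAdjoint_offDiag Y).trans (congrArg _ h)

theorem conjTranspose_mem_matrixAlg {Y : Matrix X.Index X.Index ℂ} (he : Y ∈ homog X.par 0)
    (h : Y ∈ X.matrixAlg) : Y.conjTranspose ∈ X.matrixAlg := by
  have key : ∀ {p a q b : ℕ} {Z : Matrix (Idx p a q b) (Idx p a q b) ℂ},
      strace (parity p a q b) Z = 0 → strace (parity p a q b) Z.conjTranspose = 0 :=
    fun hZ => by rw [strace_conjTranspose, hZ, star_zero]
  cases X
  · exact key h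
  · exact key h
  · exact key h
  · exact (minusAdjoint_conjTranspose he).trans (congrArg _ h)

theorem commutator_mem_matrixAlg {Y Z : Matrix X.Index X.Index ℂ} (he : Y ∈ homog X.par 0)
    (hY : Y ∈ X.matrixAlg) (hZ : Z ∈ X.matrixAlg) : Y * Z - Z * Y ∈ X.matrixAlg := by
  cases X
  · exact strace_commutator _ he Z
  · exact strace_commutator _ he Z
  · exact strace_commutator _ he Z
  · exact (minusAdjoint_commutator he Z).trans (congrArg₂ (fun A B => A * B - B * A) hY hZ)

theorem sigma_mk (Y : Matrix X.Index X.Index ℂ) :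
    X.sigma ((scalars X.Index).mkQ Y) = (scalars X.Index).mkQ (X.sigmaMatrix Y) := rfl

theorem mkQ_diagonal_mem_cartan {d : X.Index → ℂ}
    (h1 : Matrix.diagonal d ∈ X.matrixAlg)
    (h2 : X.sigmaMatrix (Matrix.diagonal d) = Matrix.diagonal d) :
    (scalars X.Index).mkQ (Matrix.diagonal d) ∈ X.cartan :=
  ⟨⟨⟨_, h1, rfl⟩, ⟨_, ⟨d, rfl⟩, rfl⟩⟩, congrArg (scalars X.Index).mkQ h2⟩

variable (X)

/-- There is an integral diagonal element of the Cartan subalgebra whose eigenvalue determines,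
within an eigenspace of `σ`, the parity of a matrix entry. -/
theorem exists_weight_parity : ∃ n : X.Index → ℤ,
    (scalars X.Index).mkQ (Matrix.diagonal fun i => (n i : ℂ)) ∈ X.cartan ∧
    ∀ (c : ℂ) (Y Z : Matrix X.Index X.Index ℂ), X.sigmaMatrix Y = c • Y → X.sigmaMatrix Z = c • Z →
      ∀ i j k l, Y i j ≠ 0 → Z k l ≠ 0 → n i - n j = n k - n l →
        X.par i + X.par j = X.par k + X.par l := by
  have hbar : ∀ {p a q b : ℕ} (i : Idx p a q b), ((oddWeight p a q b (bar p a q b i) : ℤ) : ℂ) =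
      -(oddWeight p a q b i : ℂ) := fun i => by rw [oddWeight_bar, Int.cast_neg]
  have key : ∀ {p a q b : ℕ} (c : ℂ) (Y Z : Matrix (Idx p a q b) (Idx p a q b) ℂ),
      minusAdjoint p a q b Y = c • Y → minusAdjoint p a q b Z = c • Z →
      ∀ i j k l, Y i j ≠ 0 → Z k l ≠ 0 →
      oddWeight p a q b i - oddWeight p a q b j = oddWeight p a q b k - oddWeight p a q b l →
        parity p a q b i + parity p a q b j = parity p a q b k + parity p a q b l := by
    intro p a q b c Y Z hY hZ i j k l hij hkl hn
    refine parity_add_eq_of_oddWeight hn ?_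
    -- At a nonzero entry, `σ²` multiplies by `c²` and also by the product of twist signs, so these
    -- products agree for `Y` and `Z`.
    have h1 := minusAdjoint_minusAdjoint Y i j
    have h2 := minusAdjoint_minusAdjoint Z k l
    rw [hY, map_smul, hY, Matrix.smul_apply, Matrix.smul_apply, smul_eq_mul, smul_eq_mul,
      ← mul_assoc] at h1
    rw [hZ, map_smul, hZ, Matrix.smul_apply, Matrix.smul_apply, smul_eq_mul, smul_eq_mul,
      ← mul_assoc] at h2
    exact_mod_cast (mul_right_cancel₀ hij h1).symm.trans (mul_right_cancel₀ hkl h2)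
  cases X with
  | evenOdd m n hn =>
    exact ⟨oddWeight m 1 n 0, mkQ_diagonal_mem_cartan (X := .evenOdd m n hn)
      (strace_diagonal hbar) (minusAdjoint_diagonal hbar), key⟩
  | oddOdd m n hm hn h =>
    exact ⟨oddWeight m 0 n 0, mkQ_diagonal_mem_cartan (X := .oddOdd m n hm hn h)
      (strace_diagonal hbar) (minusAdjoint_diagonal hbar), key⟩
  | evenEven m n h =>
    exact ⟨oddWeight m 1 n 1, mkQ_diagonal_mem_cartan (X := .evenEven m n h)
      (strace_diagonal hbar) (minusAdjoint_diagonal hbar), key⟩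
  | ortho m n hn =>
    refine ⟨oddWeight (m + 1) 0 n 0, mkQ_diagonal_mem_cartan (X := .ortho m n hn)
      (minusAdjoint_diagonal hbar) (conjSwap_diagonal rfl), ?_⟩
    intro c Y Z _ _ i j k l _ _ hn
    refine parity_add_eq_of_oddWeight hn ?_
    -- There is no further odd index here, so the weight alone determines the parity.
    have ht : ∀ i : Idx (m + 1) 0 n 0, twistSign (m + 1) 0 n 0 i = 1 := by
      rintro ((i | i | i) | (i | i | i))
      all_goals first | rfl | exact i.elim0
    erw [ht, ht, ht, ht]

/-- There is an integral diagonal element of the Cartan subalgebra such that no nonzero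
off-diagonal fixed point of `σ` commutes with it. -/
theorem exists_weight_generic : ∃ n : X.Index → ℤ,
    (scalars X.Index).mkQ (Matrix.diagonal fun i => (n i : ℂ)) ∈ X.cartan ∧
    ∀ Y ∈ X.matrixAlg, X.sigmaMatrix Y = Y → (∀ i, Y i i = 0) →
      (∀ i j, n i ≠ n j → Y i j = 0) → Y = 0 := by
  have hbar : ∀ {p a q b : ℕ} (c : ℕ) (i : Idx p a q b),
      ((genericWeight p a q b c (bar p a q b i) : ℤ) : ℂ) =
        -(genericWeight p a q b c i : ℂ) := fun c i => by rw [genericWeight_bar, Int.cast_neg]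
  have key : ∀ {p a q b : ℕ}, a ≤ 1 → b ≤ 1 → ∀ Y : Matrix (Idx p a q b) (Idx p a q b) ℂ,
      minusAdjoint p a q b Y = Y → (∀ i, Y i i = 0) →
      (∀ i j, genericWeight p a q b 1 i ≠ genericWeight p a q b 1 j → Y i j = 0) → Y = 0 := by
    intro p a q b ha hb Y hY hd hw
    ext i j
    by_contra hne
    have h1 := minusAdjoint_minusAdjoint Y i j
    rw [hY, hY] at h1
    -- The further even and odd indices both have weight 0; only the twist sign tells them apart.
    have h2 : twistSign p a q b i * twistSign p a q b j = 1 := by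
      exact_mod_cast (mul_right_cancel₀ hne ((one_mul _).trans h1)).symm
    have h3 : genericWeight p a q b 1 i = genericWeight p a q b 1 j := by
      by_contra h
      exact hne (hw i j h)
    have h4 : i ≠ j := fun h => hne (by rw [h, hd]; rfl)
    rcases i with (i | i | i) | (i | i | i) <;> rcases j with (j | j | j) | (j | j | j) <;>
      simp only [genericWeight, twistSign] at h2 h3 <;>
      first
      | omega
      | exact h4 (by congr 3; omega)
  cases X with
  | evenOdd m n hn =>
    exact ⟨genericWeight m 1 n 0 1, mkQ_diagonal_mem_cartan (X := .evenOdd m n hn)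
      (strace_diagonal (hbar 1)) (minusAdjoint_diagonal (hbar 1)),
      fun Y _ => key le_rfl zero_le_one Y⟩
  | oddOdd m n hm hn h =>
    exact ⟨genericWeight m 0 n 0 1, mkQ_diagonal_mem_cartan (X := .oddOdd m n hm hn h)
      (strace_diagonal (hbar 1)) (minusAdjoint_diagonal (hbar 1)),
      fun Y _ => key zero_le_one zero_le_one Y⟩
  | evenEven m n h =>
    exact ⟨genericWeight m 1 n 1 1, mkQ_diagonal_mem_cartan (X := .evenEven m n h)
      (strace_diagonal (hbar 1)) (minusAdjoint_diagonal (hbar 1)),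
      fun Y _ => key le_rfl le_rfl Y⟩
  | ortho m n hn =>
    -- The reflection exchanges the first hyperbolic pair, whose weights are opposite, so they must
    -- vanish: hence the last argument `0`. Skew-adjointness of `osp` compensates for the lost
    -- separation.
    refine ⟨genericWeight (m + 1) 0 n 0 0, mkQ_diagonal_mem_cartan (X := .ortho m n hn)
      (minusAdjoint_diagonal (hbar 0)) (conjSwap_diagonal (by simp [genericWeight])), ?_⟩
    exact fun Y hY _ hd hw => eq_zero_of_genericWeight_zero hY hd hw

end AffineType

/-! ### Root spaces: evenness, `sl₂`-triples, nilpotency of `ad x`. -/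

namespace AffineType

variable {X : AffineType} {ζ : ℂ} {α β : X.Weight} {k l : ℤ}

theorem order_ne_zero (X : AffineType) : X.order ≠ 0 := by
  cases X <;> simp [order]

theorem cartan_le_pglPart_zero {x : PGL X.Index} (h : x ∈ X.cartan) : x ∈ pglPart X.par 0 := by
  obtain ⟨_, ⟨d, rfl⟩, rfl⟩ := h.1.2
  exact (mkQ_mem_pglPart_zero _).2 (diagonal_mem_homog _ d)

theorem cartan_exists_diagonal {x : PGL X.Index} (h : x ∈ X.cartan) :
    ∃ d : X.Index → ℂ, (scalars X.Index).mkQ (Matrix.diagonal d) = x := by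
  obtain ⟨_, ⟨d, rfl⟩, rfl⟩ := h.1.2
  exact ⟨d, rfl⟩

theorem mem_eigenWeight_iff {x : PGL X.Index} : x ∈ X.eigenWeight ζ α k ↔
    x ∈ X.alg ∧ X.sigma x = ζ ^ k • x ∧
      ∀ h : X.cartan, pglBracket X.par h x = α h • x := by
  simp only [eigenWeight, eigen, Submodule.mem_inf, Submodule.mem_iInf, LinearMap.mem_eqLocus,
    LinearMap.smul_apply, LinearMap.id_apply, and_assoc]

theorem cartan_le_eigenWeight (ζ : ℂ) : X.cartan ≤ X.eigenWeight ζ 0 0 := by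
  intro x hx
  refine mem_eigenWeight_iff.2 ⟨hx.1.1, by simpa using hx.2, fun h => ?_⟩
  obtain ⟨d, hd⟩ := cartan_exists_diagonal h.2
  obtain ⟨d', rfl⟩ := cartan_exists_diagonal hx
  rw [← hd, pglBracket_mk_of_even _ (diagonal_mem_homog _ d)]
  simp [Matrix.diagonal_mul_diagonal, mul_comm]

theorem pglComp_mem_eigenWeight (e : ZMod 2) {x : PGL X.Index} (hx : x ∈ X.eigenWeight ζ α k) :
    pglComp X.par e x ∈ X.eigenWeight ζ α k := by
  obtain ⟨⟨A, hA, rfl⟩, h2, h3⟩ := mem_eigenWeight_iff.1 hx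
  refine mem_eigenWeight_iff.2 ⟨⟨_, comp_mem_matrixAlg e hA, rfl⟩, ?_, fun h => ?_⟩
  · rw [pglComp_mk, sigma_mk, sigmaMatrix_comp, ← pglComp_mk, ← sigma_mk, h2, map_smul,
      pglComp_mk]
  · have := congrArg (pglComp X.par e) (h3 h)
    obtain ⟨d, hd⟩ := cartan_exists_diagonal h.2
    rw [← hd, pglBracket_mk_of_even _ (diagonal_mem_homog _ d), pglComp_mk,
      comp_commutator_diagonal, map_smul, pglComp_mk] at this
    rw [← hd, pglComp_mk, pglBracket_mk_of_even _ (diagonal_mem_homog _ d), this]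

theorem sigma_pglBracket {x : PGL X.Index} (hx : x ∈ pglPart X.par 0) (y : PGL X.Index) :
    X.sigma (pglBracket X.par x y) = pglBracket X.par (X.sigma x) (X.sigma y) := by
  obtain ⟨A, hA, rfl⟩ := hx
  obtain ⟨B, rfl⟩ := (scalars X.Index).mkQ_surjective y
  rw [pglBracket_mk_of_even _ hA, sigma_mk, sigma_mk, sigma_mk,
    pglBracket_mk_of_even _ (sigmaMatrix_mem_homog hA), sigmaMatrix_commutator hA]

theorem pglBracket_mem_alg {x y : PGL X.Index} (he : x ∈ pglPart X.par 0) (hx : x ∈ X.alg)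
    (hy : y ∈ X.alg) : pglBracket X.par x y ∈ X.alg := by
  obtain ⟨A, hA, rfl⟩ := hx
  obtain ⟨B, hB, rfl⟩ := hy
  rw [mkQ_mem_pglPart_zero] at he
  rw [pglBracket_mk_of_even _ he]
  exact ⟨_, commutator_mem_matrixAlg he hA hB, rfl⟩

theorem pglBracket_mem_eigenWeight (hζ : ζ ≠ 0) {x y : PGL X.Index}
    (he : x ∈ pglPart X.par 0) (hx : x ∈ X.eigenWeight ζ α k) (hy : y ∈ X.eigenWeight ζ β l) :
    pglBracket X.par x y ∈ X.eigenWeight ζ (α + β) (k + l) := by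
  obtain ⟨hx1, hx2, hx3⟩ := mem_eigenWeight_iff.1 hx
  obtain ⟨hy1, hy2, hy3⟩ := mem_eigenWeight_iff.1 hy
  refine mem_eigenWeight_iff.2 ⟨pglBracket_mem_alg he hx1 hy1, ?_, fun h => ?_⟩
  · rw [sigma_pglBracket he, hx2, hy2, map_smul, map_smul, LinearMap.smul_apply, smul_smul,
      zpow_add₀ hζ, mul_comm]
  · rw [pglBracket_jacobi _ (cartan_le_pglPart_zero h.2) he, hx3, hy3, map_smul, map_smul,
      LinearMap.smul_apply, LinearMap.add_apply, add_smul]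

/-- Equations modulo scalars are ambiguous by a multiple of the identity, which is diagonal; off the
diagonal they hold exactly. -/
theorem offDiag_of_mem_eigenWeight {Y : Matrix X.Index X.Index ℂ}
    (h : (scalars X.Index).mkQ Y ∈ X.eigenWeight ζ α k) :
    X.sigmaMatrix (offDiag Y) = ζ ^ k • offDiag Y ∧
      ∀ (x : X.cartan) (d : X.Index → ℂ), (scalars X.Index).mkQ (Matrix.diagonal d) = x →
        (∀ i j, offDiag Y i j ≠ 0 → d i - d j = α x) ∧
          ∃ c : ℂ, ∀ i, α x * Y i i = c := by
  obtain ⟨-, h2, h3⟩ := mem_eigenWeight_iff.1 h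
  constructor
  · rw [sigma_mk, ← map_smul] at h2
    obtain ⟨c, hc⟩ := mkQ_scalars_eq_iff.1 h2
    rw [sigmaMatrix_offDiag, hc, map_add, map_smul, map_smul, offDiag_one, smul_zero, add_zero]
  · intro x d hd
    have := h3 x
    rw [← hd, pglBracket_mk_of_even _ (diagonal_mem_homog _ d), ← map_smul] at this
    obtain ⟨c, hc⟩ := mkQ_scalars_eq_iff.1 this
    refine ⟨fun i j hij => ?_, -c, fun i => ?_⟩
    · have hne : i ≠ j := fun h => hij (by simp [offDiag_apply, h])
      rw [offDiag_apply, if_neg hne] at hij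
      have := congrFun (congrFun hc i) j
      simp only [Matrix.sub_apply, Matrix.diagonal_mul, Matrix.mul_diagonal, Matrix.add_apply,
        Matrix.smul_apply, Matrix.one_apply_ne hne, smul_eq_mul, mul_zero, add_zero] at this
      refine mul_right_cancel₀ hij ?_
      linear_combination this
    · have := congrFun (congrFun hc i) i
      simp only [Matrix.sub_apply, Matrix.diagonal_mul, Matrix.mul_diagonal, Matrix.add_apply,
        Matrix.smul_apply, Matrix.one_apply_eq, smul_eq_mul, mul_one] at this
      linear_combination -this

/-- A commutator with a diagonal matrix has zero diagonal. If `α x ≠ 0`, the weight equation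
therefore makes the diagonal of `Y` constant, hence zero modulo scalars. -/
theorem mkQ_offDiag_of_mem_eigenWeight (hα : α ≠ 0) {Y : Matrix X.Index X.Index ℂ}
    (h : (scalars X.Index).mkQ Y ∈ X.eigenWeight ζ α k) :
    (scalars X.Index).mkQ (offDiag Y) = (scalars X.Index).mkQ Y := by
  obtain ⟨x, hx⟩ : ∃ x, α x ≠ 0 := by
    by_contra! hne
    exact hα (LinearMap.ext hne)
  obtain ⟨d, hd⟩ := cartan_exists_diagonal x.2
  obtain ⟨c, hc⟩ := ((offDiag_of_mem_eigenWeight h).2 x d hd).2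
  refine (mkQ_scalars_eq_iff.2 ⟨c / α x, ?_⟩).symm
  conv_lhs => rw [← offDiag_add_diagonal Y]
  congr 1
  ext i j
  by_cases hij : i = j
  · subst hij
    rw [← hc i]
    simp [mul_div_cancel_left₀ _ hx]
  · simp [hij]

theorem eigenWeight_zero_le_cartan : X.eigenWeight ζ 0 0 ≤ X.cartan := by
  intro x hx
  obtain ⟨hx1, hx2, -⟩ := mem_eigenWeight_iff.1 hx
  obtain ⟨Y, hY, rfl⟩ := hx1
  obtain ⟨h2, h3⟩ := offDiag_of_mem_eigenWeight hx
  obtain ⟨n, hn, hgen⟩ := exists_weight_generic X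
  have h0 : offDiag Y = 0 := by
    refine hgen _ (offDiag_mem_matrixAlg hY) (by simpa using h2) (fun i => by simp [offDiag_apply])
      fun i j hij => ?_
    by_contra hne
    have := (h3 ⟨_, hn⟩ _ rfl).1 i j hne
    rw [LinearMap.zero_apply, sub_eq_zero] at this
    exact hij (by exact_mod_cast this)
  have h4 := offDiag_add_diagonal Y
  rw [h0, zero_add] at h4
  exact ⟨⟨⟨Y, hY, rfl⟩, ⟨Y, ⟨_, h4⟩, rfl⟩⟩, by simpa using hx2⟩

/-- An element of the root space of an even root that is not a multiple of `δ` is represented by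
an even matrix without diagonal entries. -/
theorem exists_even_rep (hα : α ≠ 0) (hR : (α, k) ∈ X.evenRoots ζ) {x : PGL X.Index}
    (hx : x ∈ X.eigenWeight ζ α k) :
    ∃ Y ∈ X.matrixAlg, (scalars X.Index).mkQ Y = x ∧ Y ∈ homog X.par 0 ∧ (∀ i, Y i i = 0) ∧
      X.sigmaMatrix Y = ζ ^ k • Y ∧
      ∀ (h : X.cartan) (d : X.Index → ℂ), (scalars X.Index).mkQ (Matrix.diagonal d) = h →
        ∀ i j, Y i j ≠ 0 → d i - d j = α h := by
  obtain ⟨Y, hY, rfl⟩ := (mem_eigenWeight_iff.1 hx).1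
  obtain ⟨h1, h2⟩ := offDiag_of_mem_eigenWeight hx
  refine ⟨offDiag Y, offDiag_mem_matrixAlg hY, mkQ_offDiag_of_mem_eigenWeight hα hx, ?_,
    fun i => by simp [offDiag_apply], h1, fun h d hd => (h2 h d hd).1⟩
  obtain ⟨f, ⟨⟨z, hz, rfl⟩, hf⟩, hne⟩ := Submodule.exists_mem_ne_zero_of_ne_bot hR
  have hz0 : z ≠ 0 := fun h => hne (by rw [h, map_zero])
  have hze : z ∈ pglPart X.par 0 := by simpa using hf k
  obtain ⟨Z, rfl⟩ := (scalars X.Index).mkQ_surjective z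
  rw [mkQ_mem_pglPart_zero] at hze
  obtain ⟨h3, h4⟩ := offDiag_of_mem_eigenWeight hz
  obtain ⟨i, j, hij⟩ : ∃ i j, offDiag Z i j ≠ 0 := by
    by_contra! h0
    have : offDiag Z = 0 := by
      ext i j
      exact h0 i j
    rw [← mkQ_offDiag_of_mem_eigenWeight hα hz, this, map_zero] at hz0
    exact hz0 rfl
  -- `Z` is a nonzero even vector of the same root. Its entry at `(i, j)` is the reference that
  -- forces each nonzero entry of `offDiag Y` to be even.
  obtain ⟨n, hn, hpar⟩ := exists_weight_parity X
  intro i' j' hne'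
  by_contra hij'
  refine hne' ?_
  have hw := ((h2 ⟨_, hn⟩ _ rfl).1 i' j' hij').trans ((h4 ⟨_, hn⟩ _ rfl).1 i j hij).symm
  rw [hpar _ _ _ h1 h3 i' j' i j hij' hij (by exact_mod_cast hw),
    par_eq_of_even _ (offDiag_mem_homog _ hze) hij, CharTwo.add_self_eq_zero]

theorem mem_pglPart_zero_of_evenRoot (hα : α ≠ 0) (hR : (α, k) ∈ X.evenRoots ζ)
    {x : PGL X.Index} (hx : x ∈ X.eigenWeight ζ α k) : x ∈ pglPart X.par 0 := by
  obtain ⟨Y, -, rfl, he, -⟩ := exists_even_rep hα hR hx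
  exact (mkQ_mem_pglPart_zero _).2 he

open scoped ComplexOrder in
-- Take `y` proportional to `Y*` and `H = [Y, Y*]`. Invariance of the trace and positivity of
-- `tr(YY*)` show `α(H) ≠ 0`, so no classification of the roots is needed.
theorem exists_sl2Triple (hζ : ‖ζ‖ = 1) (hα : α ≠ 0) (hR : (α, k) ∈ X.evenRoots ζ)
    {x : PGL X.Index} (hx : x ∈ X.eigenWeight ζ α k) (hx0 : x ≠ 0) :
    ∃ y ∈ X.eigenWeight ζ (-α) (-k), y ∈ pglPart X.par 0 ∧
      ∃ h : X.cartan, pglBracket X.par x y = h ∧ α h = 2 := by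
  have hζ0 : ζ ≠ 0 := fun h => by simp [h] at hζ
  obtain ⟨Y, hY, rfl, he, hd, hs, hw⟩ := exists_even_rep hα hR hx
  -- Because `|ζ| = 1`, conjugation inverts the eigenvalue of `σ`.
  have hstar : star (ζ ^ k) = ζ ^ (-k) := by
    have h1 : star ζ = ζ⁻¹ := (Complex.inv_eq_conj hζ).symm
    rw [star_zpow₀, h1, inv_zpow, zpow_neg]
  have hy : (scalars X.Index).mkQ Y.conjTranspose ∈ X.eigenWeight ζ (-α) (-k) := by
    refine mem_eigenWeight_iff.2 ⟨⟨_, conjTranspose_mem_matrixAlg he hY, rfl⟩, ?_, fun h => ?_⟩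
    · rw [sigma_mk, sigmaMatrix_conjTranspose he, hs, Matrix.conjTranspose_smul, hstar, map_smul]
    · obtain ⟨d, hd⟩ := cartan_exists_diagonal h.2
      rw [← hd, pglBracket_mk_of_even _ (diagonal_mem_homog _ d), ← map_smul]
      congr 1
      ext i j
      simp only [Matrix.sub_apply, Matrix.diagonal_mul, Matrix.mul_diagonal, Matrix.smul_apply,
        Matrix.conjTranspose_apply, LinearMap.neg_apply, smul_eq_mul]
      by_cases hji : Y j i = 0
      · simp [hji]
      · linear_combination -(star (Y j i)) * hw h d hd j i hji
  have hye : (scalars X.Index).mkQ Y.conjTranspose ∈ pglPart X.par 0 :=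
    (mkQ_mem_pglPart_zero _).2 (homog_conjTranspose _ he)
  have hH : pglBracket X.par ((scalars X.Index).mkQ Y) ((scalars X.Index).mkQ Y.conjTranspose) ∈
      X.cartan := by
    have := pglBracket_mem_eigenWeight hζ0 ((mkQ_mem_pglPart_zero _).2 he) hx hy
    rw [add_neg_cancel, add_neg_cancel] at this
    exact eigenWeight_zero_le_cartan this
  set H := Y * Y.conjTranspose - Y.conjTranspose * Y with hHdef
  rw [pglBracket_mk_of_even _ he, ← hHdef] at hH
  have hHe : H ∈ homog X.par 0 := commutator_mem_homog _ he (homog_conjTranspose _ he)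
  have htr : ∀ (h : X.cartan) (D : Matrix X.Index X.Index ℂ), D ∈ homog X.par 0 →
      (scalars X.Index).mkQ D = h → (D * H).trace = α h * (Y * Y.conjTranspose).trace := by
    intro h D hD hDh
    have h1 := (mem_eigenWeight_iff.1 hx).2.2 h
    rw [← hDh, pglBracket_mk_of_even _ hD, ← map_smul] at h1
    obtain ⟨c, hc⟩ := mkQ_scalars_eq_iff.1 h1
    -- The scalar ambiguity `c` contributes `c · tr(Y*)`, which vanishes since `Y` has zero
    -- diagonal.
    have h2 : Y.conjTranspose.trace = 0 := by simp [Matrix.trace, hd]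
    calc (D * H).trace = ((D * Y - Y * D) * Y.conjTranspose).trace := by
          rw [hHdef, mul_sub, sub_mul, Matrix.trace_sub, Matrix.trace_sub, mul_assoc,
            ← mul_assoc D Y.conjTranspose, Matrix.trace_mul_comm (D * Y.conjTranspose), mul_assoc]
      _ = α h * (Y * Y.conjTranspose).trace := by
          rw [hc, add_mul, Matrix.trace_add, smul_mul_assoc, smul_mul_assoc, one_mul,
            Matrix.trace_smul, Matrix.trace_smul, h2, smul_zero, add_zero, smul_eq_mul]
  have hY0 : (Y * Y.conjTranspose).trace ≠ 0 := fun h0 => hx0 (by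
    rw [Matrix.trace_mul_conjTranspose_self_eq_zero_iff.1 h0, map_zero])
  -- If `α(H) = 0`, then `tr(HH*) = tr(H²) = 0` and `H = 0`. Then `α(h) tr(YY*) = 0` for all `h` in
  -- `𝔥`, although `tr(YY*) ≠ 0` and `α ≠ 0`.
  have hα0 : α ⟨_, hH⟩ ≠ 0 := by
    intro h0
    have h1 := htr ⟨_, hH⟩ H hHe rfl
    have h2 : H.conjTranspose = H := by simp [hHdef]
    rw [h0, zero_mul] at h1
    nth_rewrite 2 [← h2] at h1
    have h3 := Matrix.trace_mul_conjTranspose_self_eq_zero_iff.1 h1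
    obtain ⟨h, hh⟩ : ∃ h, α h ≠ 0 := by
      by_contra! hne
      exact hα (LinearMap.ext hne)
    obtain ⟨d, hd'⟩ := cartan_exists_diagonal h.2
    have h4 := htr h _ (diagonal_mem_homog _ d) hd'
    rw [h3, mul_zero, Matrix.trace_zero] at h4
    exact mul_ne_zero hh hY0 h4.symm
  set h : X.cartan := ⟨_, hH⟩ with hh
  refine ⟨(2 / α h) • (scalars X.Index).mkQ Y.conjTranspose, Submodule.smul_mem _ _ hy,
    Submodule.smul_mem _ _ hye, (2 / α h) • h, ?_, ?_⟩
  · rw [map_smul, pglBracket_mk_of_even _ he]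
    rfl
  · rw [map_smul, smul_eq_mul, div_mul_cancel₀ _ hα0]

/-- Otherwise, for `h` with `α h ≠ 0`, the values of `nα + β` at `h` would be infinitely many
eigenvalues of `ad h` on a finite dimensional space. -/
theorem pglBracket_pow_eq_zero (hζ : ζ ≠ 0) {x y : PGL X.Index} (he : x ∈ pglPart X.par 0)
    (hα : α ≠ 0) (hx : x ∈ X.eigenWeight ζ α k) (hy : y ∈ X.eigenWeight ζ β l) :
    ∃ n : ℕ, ((pglBracket X.par x) ^ n) y = 0 := by
  obtain ⟨h, hh⟩ : ∃ h, α h ≠ 0 := by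
    by_contra! hne
    exact hα (LinearMap.ext hne)
  have hmem : ∀ n : ℕ, ((pglBracket X.par x) ^ n) y ∈ X.eigenWeight ζ (n • α + β) (n • k + l) := by
    intro n
    induction n with
    | zero => simpa using hy
    | succ n ih =>
      have := pglBracket_mem_eigenWeight hζ he hx ih
      rwa [← add_assoc, ← add_assoc, ← succ_nsmul', ← succ_nsmul', ← Module.End.mul_apply,
        ← pow_succ'] at this
  by_contra! hne
  refine Set.infinite_of_injective_forall_mem (f := fun n : ℕ => (n • α + β) h) ?_
    (s := {μ | Module.End.HasEigenvalue (pglBracket X.par (h : PGL X.Index)) μ}) (fun n => ?_)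
    (Module.End.finite_hasEigenvalue _)
  · intro m n hmn
    simpa [hh] using hmn
  · exact Module.End.hasEigenvalue_of_hasEigenvector
      ⟨Module.End.mem_eigenspace_iff.2 ((mem_eigenWeight_iff.1 (hmem n)).2.2 h), hne n⟩

end AffineType

/-! ### Weight modules over `sl₂`. -/

section Sl2

open Module.End

variable {V : Type*} [AddCommGroup V] [Module ℂ V]

/-- The last nonzero vector among `v, e v, e² v, …` is singular. -/
theorem exists_mem_ker_of_pow_eq_zero {e : Module.End ℂ V} {U : ℕ → Submodule ℂ V}
    (hU : ∀ s, ∀ v ∈ U s, e v ∈ U (s + 1)) (n : ℕ) :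
    ∀ s, ∀ v ∈ U s, v ≠ 0 → (e ^ n) v = 0 → ∃ t, s ≤ t ∧ ∃ u ∈ U t, u ≠ 0 ∧ e u = 0 := by
  induction n with
  | zero => exact fun s v _ hv h => absurd (by simpa using h) hv
  | succ n ih =>
    intro s v hv hv0 h
    by_cases hev : e v = 0
    · exact ⟨s, le_rfl, v, hv, hv0, hev⟩
    · obtain ⟨t, ht, hu⟩ := ih (s + 1) (e v) (hU s v hv) hev (by
        rwa [pow_succ, Module.End.mul_apply] at h)
      exact ⟨t, by omega, hu⟩

/-- In a weight module over `sl₂` with finite dimensional weight spaces on which `e` acts locally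
nilpotently, the weights are bounded above along every `e`-string. -/
theorem finite_weights_of_sl2 {e f h : Module.End ℂ V} (hhf : h * f - f * h = (-2 : ℂ) • f) (hef : e * f - f * e = h) (c : ℂ)
    {U : ℕ → Submodule ℂ V} (hfin : ∀ s, FiniteDimensional ℂ (U s))
    (hUh : ∀ s, ∀ v ∈ U s, h v = (c + 2 * s) • v) (hUe : ∀ s, ∀ v ∈ U s, e v ∈ U (s + 1))
    (hUf : ∀ s, ∀ v ∈ U (s + 1), f v ∈ U s) (hnil : ∀ v, ∃ n : ℕ, (e ^ n) v = 0) :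
    {s | U s ≠ ⊥}.Finite := by
  by_contra hinf
  -- From `s₀` on, `Re c + t > 0`. This keeps lowered singular vectors nonzero down to level `s₀`
  -- and makes their Casimir values distinct.
  obtain ⟨s₀, hs₀⟩ := exists_nat_gt (-c.re)
  set T : Set ℕ := {t | s₀ ≤ t ∧ ∃ u ∈ U t, u ≠ 0 ∧ e u = 0} with hT
  have hTinf : T.Infinite := Set.infinite_of_forall_exists_gt fun N => by
    obtain ⟨s, hs, hNs⟩ := Set.Infinite.exists_gt hinf (max N s₀)
    obtain ⟨v, hv, hv0⟩ := Submodule.exists_mem_ne_zero_of_ne_bot hs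
    obtain ⟨n, hn⟩ := hnil v
    obtain ⟨t, ht, hu⟩ := exists_mem_ker_of_pow_eq_zero hUe n s v hv hv0 hn
    have h1 := le_max_left N s₀
    have h2 := le_max_right N s₀
    exact ⟨t, ⟨by omega, hu⟩, by omega⟩
  have hre : ∀ t, s₀ ≤ t → 0 < c.re + t := fun t ht => by
    have : (s₀ : ℝ) ≤ t := by exact_mod_cast ht
    linarith
  have hpow : ∀ t u, u ∈ U t → e u = 0 → ∀ n : ℕ,
      e ((f ^ (n + 1)) u) = ((n + 1) * (c + 2 * t - n) : ℂ) • (f ^ n) u ∧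
      h ((f ^ n) u) = (c + 2 * t - 2 * n) • (f ^ n) u := by
    intro t u hu heu
    have hh : ∀ n : ℕ, h ((f ^ n) u) = (c + 2 * t - 2 * n) • (f ^ n) u := by
      intro n
      induction n with
      | zero => simpa using hUh t u hu
      | succ n ih =>
        have := LinearMap.congr_fun hhf ((f ^ n) u)
        simp only [LinearMap.sub_apply, Module.End.mul_apply, LinearMap.smul_apply, ih,
          map_smul] at this
        rw [pow_succ', Module.End.mul_apply, sub_eq_iff_eq_add.1 this, ← add_smul]
        push_cast
        ring_nf
    intro n
    refine ⟨?_, hh n⟩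
    induction n with
    | zero =>
      have := LinearMap.congr_fun hef u
      simp only [LinearMap.sub_apply, Module.End.mul_apply, heu, map_zero, sub_zero] at this
      simpa [this] using hUh t u hu
    | succ n ih =>
      have := LinearMap.congr_fun hef ((f ^ (n + 1)) u)
      simp only [LinearMap.sub_apply, Module.End.mul_apply, hh (n + 1), ih, map_smul] at this
      rw [pow_succ' f (n + 1), Module.End.mul_apply, sub_eq_iff_eq_add.1 this,
        ← Module.End.mul_apply, ← pow_succ', ← add_smul]
      push_cast
      ring_nf
  -- The factor `c + 2t - n` cannot vanish: its real part is at least `Re c + t > 0` because `n ≤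
  -- t`.
  have hne : ∀ t u, u ∈ U t → u ≠ 0 → e u = 0 → ∀ n : ℕ, s₀ + n ≤ t → (f ^ n) u ≠ 0 := by
    intro t u hu hu0 heu n
    induction n with
    | zero => exact fun _ => by simpa using hu0
    | succ n ih =>
      intro hn h0
      have h1 := (hpow t u hu heu n).1
      rw [h0, map_zero] at h1
      rcases smul_eq_zero.1 h1.symm with h2 | h2
      · rcases mul_eq_zero.1 h2 with h3 | h3
        · exact Nat.cast_add_one_ne_zero n h3
        · have h4 := congrArg Complex.re h3
          have h5 := hre t (by omega)
          have h6 : (n : ℝ) ≤ t := by exact_mod_cast (by omega : n ≤ t)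
          simp at h4
          linarith
      · exact ih (by omega) h2
  have hmem : ∀ n s v, v ∈ U (s + n) → (f ^ n) v ∈ U s := by
    intro n
    induction n with
    | zero => exact fun s v hv => by simpa using hv
    | succ n ih =>
      intro s v hv
      rw [pow_succ, Module.End.mul_apply]
      exact ih s _ (hUf _ _ hv)
  -- This is a multiple of the Casimir operator; it preserves `U s₀` and takes the value `w(w + 2)`
  -- on the string lowered from a singular vector of weight `w`.
  have hΩ : ∀ v ∈ U s₀, ((4 : ℂ) • (f * e) + h * h + (2 : ℂ) • h) v ∈ U s₀ := by
    intro v hv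
    have h1 : f (e v) ∈ U s₀ := hUf _ _ (hUe _ _ hv)
    have h2 : h v ∈ U s₀ := by
      rw [hUh _ _ hv]
      exact Submodule.smul_mem _ _ hv
    have h3 : h (h v) ∈ U s₀ := by
      rw [hUh _ _ hv, map_smul, hUh _ _ hv]
      exact Submodule.smul_mem _ _ (Submodule.smul_mem _ _ hv)
    exact Submodule.add_mem _ (Submodule.add_mem _ (Submodule.smul_mem _ _ h1) h3)
      (Submodule.smul_mem _ _ h2)
  have := hfin s₀
  have heig : ∀ t ∈ T, HasEigenvalue
      (((4 : ℂ) • (f * e) + h * h + (2 : ℂ) • h).restrict hΩ)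
      ((c + 2 * t) * (c + 2 * t + 2)) := by
    rintro t ⟨hst, u, hu, hu0, heu⟩
    obtain ⟨n, rfl⟩ := Nat.exists_eq_add_of_le hst
    refine hasEigenvalue_of_hasEigenvector (x := ⟨(f ^ n) u, hmem n s₀ u hu⟩)
      ⟨mem_eigenspace_iff.2 (Subtype.ext ?_), fun h0 =>
        hne _ u hu hu0 heu n le_rfl (congrArg Subtype.val h0)⟩
    have h1 := (hpow _ u hu heu n).2
    have h2 : f (e ((f ^ n) u)) =
        (n * (c + 2 * ((s₀ + n : ℕ) : ℂ) - n + 1) : ℂ) • (f ^ n) u := by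
      cases n with
      | zero => simp [heu]
      | succ m =>
        rw [(hpow _ u hu heu m).1, map_smul, ← Module.End.mul_apply, ← pow_succ']
        push_cast
        ring_nf
    simp only [LinearMap.coe_restrict_apply, LinearMap.add_apply, LinearMap.smul_apply,
      Module.End.mul_apply, h1, h2, map_smul, smul_smul, ← add_smul, Submodule.coe_smul]
    congr 1
    ring
  refine (hTinf.image (f := fun t : ℕ => (c + 2 * t) * (c + 2 * t + 2)) ?_)
    ((finite_hasEigenvalue _).subset (Set.image_subset_iff.2 heig))
  intro s hs t ht hst
  -- The difference of two Casimir values factors, and the second factor has positive real part.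
  have h1 : ((s : ℂ) - t) * (2 * c + 2 * s + 2 * t + 2) = 0 := by
    simp only at hst
    linear_combination (1 / 2) * hst
  rcases mul_eq_zero.1 h1 with h2 | h2
  · exact_mod_cast sub_eq_zero.1 h2
  · have h3 := congrArg Complex.re h2
    have h4 := hre s hs.1
    have h5 := hre t ht.1
    simp at h3
    linarith

end Sl2

/-! ### Loops and the subalgebra `F(S)_cc`. -/

theorem loopBracket_single {I : Type} [Fintype I] [DecidableEq I] (par : I → ZMod 2) (k l : ℤ)
    (x y : PGL I) : loopBracket par (Finsupp.single k x) (Finsupp.single l y) =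
      Finsupp.single (k + l) (pglBracket par x y) := by
  rw [loopBracket, Finsupp.sum_single_index, Finsupp.sum_single_index] <;> simp

theorem single_mem_loopPart {I : Type} [Fintype I] [DecidableEq I] (par : I → ZMod 2) (k : ℤ)
    {e : ZMod 2} {x : PGL I} (hx : x ∈ pglPart par e) :
    (Finsupp.single k x : Loop I) ∈ loopPart par e := by
  intro l
  by_cases h : k = l
  · subst h
    rwa [Finsupp.single_eq_same]
  · rw [Finsupp.single_eq_of_ne (Ne.symm h)]
    exact Submodule.zero_mem _

namespace AffineType

variable {X : AffineType} {ζ : ℂ} {S : Set X.RootLattice}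

/-- The roots whose root spaces span `F(S)_cc`. -/
def extendedRoots (S : Set X.RootLattice) : Set X.RootLattice :=
  S ∪ Set.range fun k : ℤ => ((0 : X.Weight), 2 * k + 1)

theorem rootSpace_le_subalg {β : X.RootLattice} (hβ : β ∈ extendedRoots S) :
    X.rootSpace ζ β ≤ X.subalg ζ S := by
  rcases hβ with hβ | ⟨k, rfl⟩
  -- The sum over nonzero roots omits `β = 0`; its space lies in `𝔥`.
  · by_cases h0 : β = 0
    · subst h0
      exact (Submodule.map_mono eigenWeight_zero_le_cartan).trans
        (le_sup_left.trans le_sup_left)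
    · exact (le_iSup₂_of_le (f := fun α (_ : α ∈ S \ {0}) => X.rootSpace ζ α) β ⟨hβ, h0⟩
        le_rfl).trans (le_sup_right.trans le_sup_left)
  · exact (le_iSup (fun k : ℤ => X.rootSpace ζ (0, 2 * k + 1)) k).trans le_sup_right

theorem single_mem_subalg {β : X.RootLattice} (hβ : β ∈ extendedRoots S) {y : PGL X.Index}
    (hy : y ∈ X.eigenWeight ζ β.1 β.2) : Finsupp.single β.2 y ∈ X.subalg ζ S :=
  rootSpace_le_subalg hβ ⟨y, hy, rfl⟩

theorem subalg_le (h0 : (0 : X.RootLattice) ∈ S) {P : Submodule ℂ (Loop X.Index)}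
    (hP : ∀ β ∈ extendedRoots S, X.rootSpace ζ β ≤ P) : X.subalg ζ S ≤ P := by
  refine sup_le (sup_le ?_ (iSup₂_le fun β hβ => hP β (Or.inl hβ.1)))
    (iSup_le fun k => hP _ (Or.inr ⟨k, rfl⟩))
  exact (Submodule.map_mono (cartan_le_eigenWeight ζ)).trans (hP 0 (Or.inl h0))

/-- Closedness of `S` handles `β` in `S`; the odd multiples of `δ` need not lie in `S`, and for them
the stability under `δ`-shifts is used. -/
theorem add_mem_extendedRoots
    (hclosed : ∀ α ∈ S, ∀ β ∈ S, α + β ∈ X.roots ζ → α + β ∈ S)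
    (hshift : ∀ α ∈ S, α.1 ≠ 0 → ∀ k : ℤ, α + (0, k) ∈ X.roots ζ → α + (0, k) ∈ S)
    {α β : X.RootLattice} (hα : α ∈ S) (hα0 : α.1 ≠ 0) (hβ : β ∈ extendedRoots S)
    {z : PGL X.Index} (hz : z ∈ X.eigenWeight ζ (α.1 + β.1) (α.2 + β.2)) (hz0 : z ≠ 0) :
    α + β ∈ extendedRoots S := by
  have hR : α + β ∈ X.roots ζ := by
    intro h
    have hmem : (Finsupp.single (α.2 + β.2) z : Loop X.Index) ∈ X.rootSpace ζ (α + β) :=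
      ⟨z, hz, rfl⟩
    rw [h, Submodule.mem_bot, Finsupp.single_eq_zero] at hmem
    exact hz0 hmem
  rcases hβ with hβ | ⟨k, rfl⟩
  · exact Or.inl (hclosed α hα β hβ hR)
  · exact Or.inl (hshift α hα hα0 _ hR)

end AffineType

/-! ### Locally nilpotent action on supermodules. -/

namespace SuperModule

open AffineType

variable {X : AffineType} {V : Type*} [AddCommGroup V] [Module ℂ V]

theorem act_commutator {F : Submodule ℂ (Loop X.Index)} (M : SuperModule X F V) {j : ZMod 2}
    {x y z : F} (hx : (x : Loop X.Index) ∈ loopPart X.par 0)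
    (hy : (y : Loop X.Index) ∈ loopPart X.par j)
    (hz : (z : Loop X.Index) = loopBracket X.par x y) :
    M.act x * M.act y - M.act y * M.act x = M.act z := by
  ext v
  rw [M.act_bracket 0 j x y z v hx hy hz]
  simp

theorem locNilp_iff {F : Submodule ℂ (Loop X.Index)} (M : SuperModule X F V) (x : F) :
    M.LocNilp x ↔ (M.act x).maxGenEigenspace 0 = ⊤ := by
  simp [LocNilp, Submodule.eq_top_iff', Module.End.mem_maxGenEigenspace]

theorem act_pow_mem {F : Submodule ℂ (Loop X.Index)} (M : SuperModule X F V) {x : F}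
    (hx : (x : Loop X.Index) ∈ loopPart X.par 0) {j : ZMod 2} {v : V} (hv : v ∈ M.part j)
    (n : ℕ) : (M.act x ^ n) v ∈ M.part j := by
  induction n with
  | zero => simpa using hv
  | succ n ih =>
    rw [pow_succ', Module.End.mul_apply]
    simpa using M.act_mem 0 j x _ hx ih

/-- An even element preserves parity, so a power killing `v` kills both homogeneous components.
Simplicity concerns graded submodules only, so this is needed. -/
theorem maxGenEigenspace_graded {F : Submodule ℂ (Loop X.Index)} (M : SuperModule X F V) {x : F}
    (hx : (x : Loop X.Index) ∈ loopPart X.par 0) :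
    (M.act x).maxGenEigenspace 0 = ((M.act x).maxGenEigenspace 0 ⊓ M.part 0) ⊔
      ((M.act x).maxGenEigenspace 0 ⊓ M.part 1) := by
  refine le_antisymm (fun v hv => ?_) (sup_le inf_le_left inf_le_left)
  obtain ⟨v₀, h₀, v₁, h₁, rfl⟩ := Submodule.mem_sup.1
    (M.isCompl.sup_eq_top ▸ Submodule.mem_top : v ∈ M.part 0 ⊔ M.part 1)
  obtain ⟨n, hn⟩ := (Module.End.mem_maxGenEigenspace _ _ _).1 hv
  rw [zero_smul, sub_zero, map_add] at hn
  have h2 := M.act_pow_mem hx h₀ n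
  have h3 := M.act_pow_mem hx h₁ n
  have h4 : (M.act x ^ n) v₀ = 0 := by
    refine Submodule.disjoint_def.1 M.isCompl.disjoint _ h2 ?_
    rw [eq_neg_of_add_eq_zero_left hn]
    exact Submodule.neg_mem _ h3
  have h5 : (M.act x ^ n) v₁ = 0 := by rwa [h4, zero_add] at hn
  refine Submodule.add_mem_sup ⟨?_, h₀⟩ ⟨?_, h₁⟩
  · exact (Module.End.mem_maxGenEigenspace _ _ _).2 ⟨n, by simpa using h4⟩
  · exact (Module.End.mem_maxGenEigenspace _ _ _).2 ⟨n, by simpa using h5⟩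

theorem mem_maxGenEigenspace_of_apply_mem {e : Module.End ℂ V} {v : V}
    (h : e v ∈ e.maxGenEigenspace 0) : v ∈ e.maxGenEigenspace 0 := by
  obtain ⟨n, hn⟩ := (Module.End.mem_maxGenEigenspace _ _ _).1 h
  refine (Module.End.mem_maxGenEigenspace _ _ _).2 ⟨n + 1, ?_⟩
  rw [zero_smul, sub_zero] at hn ⊢
  rwa [pow_succ, Module.End.mul_apply]

/-- If the commutator `[e, g]` preserves the locally nilpotent vectors of `e`, so does `g`. -/
theorem maxGenEigenspace_stable {e g : Module.End ℂ V}
    (h : ∀ v ∈ e.maxGenEigenspace 0, (e * g - g * e) v ∈ e.maxGenEigenspace 0) :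
    ∀ v ∈ e.maxGenEigenspace 0, g v ∈ e.maxGenEigenspace 0 := by
  -- Induction via `e(gv) = [e, g]v + g(ev)`, where `ev` is killed by a smaller power.
  have key : ∀ n : ℕ, ∀ v, (e ^ n) v = 0 → g v ∈ e.maxGenEigenspace 0 := by
    intro n
    induction n with
    | zero =>
      intro v hv
      have : v = 0 := by simpa using hv
      simp [this]
    | succ n ih =>
      intro v hv
      refine mem_maxGenEigenspace_of_apply_mem ?_
      have h1 := h v ((Module.End.mem_maxGenEigenspace _ _ _).2 ⟨n + 1, by simpa using hv⟩)
      have h2 := ih (e v) (by rwa [pow_succ, Module.End.mul_apply] at hv)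
      have h3 := Submodule.add_mem _ h1 h2
      rwa [LinearMap.sub_apply, Module.End.mul_apply, Module.End.mul_apply,
        sub_add_cancel] at h3
  intro v hv
  obtain ⟨n, hn⟩ := (Module.End.mem_maxGenEigenspace _ _ _).1 hv
  exact key n v (by simpa using hn)

variable {ζ : ℂ} {S : Set X.RootLattice} (M : SuperModule X (X.subalg ζ S) V)

theorem mem_weightSpace_iff {μ : X.Weight} {v : V} :
    v ∈ M.weightSpace μ ↔ ∀ h : X.cartan, M.act (X.cartanElt ζ S h) v = μ h • v := by
  simp [weightSpace, Submodule.mem_iInf, LinearMap.mem_eqLocus]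

theorem cartanElt_mem_loopPart (h : X.cartan) :
    (X.cartanElt ζ S h : Loop X.Index) ∈ loopPart X.par 0 :=
  single_mem_loopPart _ _ (cartan_le_pglPart_zero h.2)

theorem act_cartan_commutator {α : X.Weight} {k : ℤ} {x : X.subalg ζ S} {x' : PGL X.Index}
    (he : x' ∈ pglPart X.par 0) (hx' : x' ∈ X.eigenWeight ζ α k)
    (hx : (x : Loop X.Index) = Finsupp.single k x') (h : X.cartan) :
    M.act (X.cartanElt ζ S h) * M.act x - M.act x * M.act (X.cartanElt ζ S h) =
      α h • M.act x := by
  rw [M.act_commutator (z := α h • x) (cartanElt_mem_loopPart h)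
    (by rw [hx]; exact single_mem_loopPart _ _ he), map_smul]
  rw [hx, cartanElt, loopBracket_single, (mem_eigenWeight_iff.1 hx').2.2, zero_add,
    Submodule.coe_smul, hx, Finsupp.smul_single]

theorem act_mem_weightSpace {α : X.Weight} {k : ℤ} {x : X.subalg ζ S} {x' : PGL X.Index}
    (he : x' ∈ pglPart X.par 0) (hx' : x' ∈ X.eigenWeight ζ α k)
    (hx : (x : Loop X.Index) = Finsupp.single k x') {μ : X.Weight} {v : V}
    (hv : v ∈ M.weightSpace μ) : M.act x v ∈ M.weightSpace (μ + α) := by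
  rw [mem_weightSpace_iff] at hv ⊢
  intro h
  have := LinearMap.congr_fun (M.act_cartan_commutator he hx' hx h) v
  rw [LinearMap.sub_apply, Module.End.mul_apply, Module.End.mul_apply, hv, map_smul,
    sub_eq_iff_eq_add, LinearMap.smul_apply] at this
  rw [this, LinearMap.add_apply, add_smul, add_comm]

theorem act_pow_mem_weightSpace {α : X.Weight} {k : ℤ} {x : X.subalg ζ S} {x' : PGL X.Index}
    (he : x' ∈ pglPart X.par 0) (hx' : x' ∈ X.eigenWeight ζ α k)
    (hx : (x : Loop X.Index) = Finsupp.single k x') {μ : X.Weight} {v : V}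
    (hv : v ∈ M.weightSpace μ) (n : ℕ) : (M.act x ^ n) v ∈ M.weightSpace (μ + n • α) := by
  induction n with
  | zero => simpa using hv
  | succ n ih =>
    rw [pow_succ', Module.End.mul_apply, succ_nsmul, ← add_assoc]
    exact M.act_mem_weightSpace he hx' hx ih

theorem supp_nonempty [Nontrivial V] (hfin : M.IsFiniteWeight) : M.supp.Nonempty := by
  by_contra! h
  have : ∀ μ, M.weightSpace μ = ⊥ := fun μ => by
    by_contra hne
    exact (Set.eq_empty_iff_forall_notMem.1 h) μ hne
  have h1 := hfin.2.1
  simp [this] at h1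

variable {M}

/-- On a simple module, an element of the root space of a root in `S` acts locally nilpotently as
soon as it acts nilpotently on one nonzero vector. -/
theorem locNilp_of_pow_act_eq_zero (hζ : ζ ≠ 0)
    (hclosed : ∀ α ∈ S, ∀ β ∈ S, α + β ∈ X.roots ζ → α + β ∈ S)
    (hshift : ∀ α ∈ S, α.1 ≠ 0 → ∀ k : ℤ, α + (0, k) ∈ X.roots ζ → α + (0, k) ∈ S)
    (h0 : (0 : X.RootLattice) ∈ S) (hsimple : M.IsSimple) {α : X.Weight} (hα : α ≠ 0) {k : ℤ}
    (hk : (α, k) ∈ S) {x : X.subalg ζ S} {x' : PGL X.Index} (he : x' ∈ pglPart X.par 0)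
    (hx' : x' ∈ X.eigenWeight ζ α k) (hx : (x : Loop X.Index) = Finsupp.single k x') {v : V}
    (hv : v ≠ 0) {n : ℕ} (hn : (M.act x ^ n) v = 0) : M.LocNilp x := by
  have hxe : (x : Loop X.Index) ∈ loopPart X.par 0 := by
    rw [hx]
    exact single_mem_loopPart _ _ he
  set W := (M.act x).maxGenEigenspace 0 with hW
  -- Induction on the exponent with which `ad x'` kills `y`: the bracket `[x', y]` has a smaller
  -- one, so it preserves `W`, and then so does `y`.
  have key : ∀ n : ℕ, ∀ β ∈ extendedRoots S, ∀ (j : ZMod 2) (y : PGL X.Index),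
      y ∈ pglPart X.par j → y ∈ X.eigenWeight ζ β.1 β.2 → ((pglBracket X.par x') ^ n) y = 0 →
      ∀ y' : X.subalg ζ S, (y' : Loop X.Index) = Finsupp.single β.2 y →
        ∀ w ∈ W, M.act y' w ∈ W := by
    intro n
    induction n with
    | zero =>
      intro β hβ j y hyj hy h y' hy' w hw
      have : y = 0 := by simpa using h
      have : y' = 0 := Subtype.ext (by rw [hy', this, Finsupp.single_zero]; rfl)
      simp [this]
    | succ n ih =>
      intro β hβ j y hyj hy h y' hy'
      refine maxGenEigenspace_stable fun w hw => ?_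
      have hz := pglBracket_mem_eigenWeight hζ he hx' hy
      have hzj := pglBracket_mem_pglPart _ he hyj
      have hye : (y' : Loop X.Index) ∈ loopPart X.par j := by
        rw [hy']
        exact single_mem_loopPart _ _ hyj
      by_cases hz0 : pglBracket X.par x' y = 0
      · rw [M.act_commutator (z := 0) hxe hye (by
          rw [hx, hy', loopBracket_single, hz0, Finsupp.single_zero]; rfl)]
        simp
      · have hβ' := add_mem_extendedRoots hclosed hshift hk hα hβ hz hz0
        rw [M.act_commutator (z := ⟨_, single_mem_subalg hβ' hz⟩) hxe hye (by
          rw [hx, hy', loopBracket_single]; rfl)]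
        exact ih _ hβ' j _ hzj hz (by rwa [pow_succ, Module.End.mul_apply] at h) _ rfl w hw
  have hstable : ∀ y : X.subalg ζ S, ∀ w ∈ W, M.act y w ∈ W := by
    let P : Submodule ℂ (X.subalg ζ S) :=
      { carrier := {y | ∀ w ∈ W, M.act y w ∈ W}
        zero_mem' := fun w _ => by simp
        add_mem' := fun ha hb w hw => by
          rw [map_add]
          exact Submodule.add_mem _ (ha w hw) (hb w hw)
        smul_mem' := fun c a ha w hw => by
          rw [map_smul]
          exact Submodule.smul_mem _ _ (ha w hw) }
    have hP : X.subalg ζ S ≤ P.map (X.subalg ζ S).subtype := by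
      refine subalg_le h0 fun β hβ => ?_
      rintro _ ⟨y, hy, rfl⟩
      -- The bracket relation of a supermodule is available for homogeneous elements only, so `y` is
      -- split by parity.
      have hj : ∀ j : ZMod 2, (Finsupp.single β.2 (pglComp X.par j y) : Loop X.Index) ∈
          P.map (X.subalg ζ S).subtype := fun j => by
        have hy' := pglComp_mem_eigenWeight j hy
        obtain ⟨n, hn⟩ := pglBracket_pow_eq_zero hζ he hα hx' hy'
        exact ⟨⟨_, single_mem_subalg hβ hy'⟩,
          key n β hβ j _ (pglComp_mem_pglPart _ j y) hy' hn _ rfl, rfl⟩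
      have := Submodule.add_mem _ (hj 0) (hj 1)
      rwa [← Finsupp.single_add, pglComp_add_pglComp] at this
    intro y
    obtain ⟨y', hy', hyy⟩ := hP y.2
    obtain rfl : y' = y := Subtype.ext hyy
    exact hy'
  rcases hsimple.2 W (M.maxGenEigenspace_graded hxe) hstable with h | h
  · refine absurd ?_ hv
    rw [← Submodule.mem_bot ℂ, ← h]
    exact (Module.End.mem_maxGenEigenspace _ _ _).2 ⟨n, by simpa using hn⟩
  · exact (M.locNilp_iff x).2 h

/-- If a nonzero element of an even root space in `F(S)_cc` acts locally nilpotently on a finite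
weight module, then the weights are bounded above in the direction of the root. -/
theorem finite_string_of_locNilp (hζ : ‖ζ‖ = 1) (hS : S ⊆ X.evenRoots ζ)
    (hsymm : ∀ α ∈ S, -α ∈ S) (hfin : M.IsFiniteWeight) {α : X.Weight} (hα : α ≠ 0) {k : ℤ}
    (hk : (α, k) ∈ S) {x : X.subalg ζ S} (hx0 : x ≠ 0)
    (hx : (x : Loop X.Index) ∈ X.rootSpace ζ (α, k)) (hnil : M.LocNilp x) (μ : X.Weight) :
    {s : ℕ | 0 < s ∧ μ + s • α ∈ M.supp}.Finite := by
  obtain ⟨x', hx', hxx⟩ := hx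
  have hxx : (x : Loop X.Index) = Finsupp.single k x' := hxx.symm
  have hx'0 : x' ≠ 0 := fun h => hx0 (Subtype.ext (by rw [hxx, h, Finsupp.single_zero]; rfl))
  have he := mem_pglPart_zero_of_evenRoot hα (hS hk) hx'
  obtain ⟨y', hy', hye, h, hxy, hαh⟩ := exists_sl2Triple hζ hα (hS hk) hx' hx'0
  let y : X.subalg ζ S := ⟨Finsupp.single (-k) y',
    single_mem_subalg (β := (-α, -k)) (Or.inl (hsymm _ hk)) hy'⟩
  -- Since `α h = 2`, the element `h` acts on `V^{μ + sα}` by `μ h + 2s`.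
  refine (finite_weights_of_sl2 (e := M.act x) (f := M.act y)
    (h := M.act (X.cartanElt ζ S h)) ?_ ?_ (μ h) (U := fun s : ℕ => M.weightSpace (μ + s • α))
    (fun s => hfin.2.2 _) (fun s v hv => ?_) (fun s v hv => ?_) (fun s v hv => ?_)
    hnil).subset fun s hs => hs.2
  · rw [M.act_cartan_commutator hye hy' (x := y) rfl, LinearMap.neg_apply, hαh]
  · refine M.act_commutator (j := 0) ?_ (single_mem_loopPart _ _ hye) ?_
    · rw [hxx]
      exact single_mem_loopPart _ _ he
    · rw [hxx, loopBracket_single, hxy, add_neg_cancel]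
      rfl
  · rw [M.mem_weightSpace_iff.1 hv h]
    simp [hαh, mul_comm]
  · have := M.act_mem_weightSpace he hx' hxx hv
    rwa [add_assoc, ← succ_nsmul] at this
  · have := M.act_mem_weightSpace hye hy' (x := y) rfl hv
    rwa [succ_nsmul, ← add_assoc, add_neg_cancel_right] at this

end SuperModule

end TwistedAffine

end

/-! ### The equivalence. -/

open TwistedAffine in
theorem mainTheorem4 (X : AffineType) (ζ : ℂ) (hζ : IsPrimitiveRoot ζ X.order)
    (S : Set X.RootLattice) (hS : S ⊆ X.evenRoots ζ)
    (hsymm : ∀ α ∈ S, -α ∈ S)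
    (hclosed : ∀ α ∈ S, ∀ β ∈ S, α + β ∈ X.roots ζ → α + β ∈ S)
    (hshift : ∀ α ∈ S, α.1 ≠ 0 → ∀ k : ℤ, α + (0, k) ∈ X.roots ζ → α + (0, k) ∈ S)
    (him : ∀ k : ℤ, (0, 2 * k) ∈ S)
    {V : Type*} [AddCommGroup V] [Module ℂ V]
    (M : SuperModule X (X.subalg ζ S) V) (hsimple : M.IsSimple) (hfin : M.IsFiniteWeight)
    (α : X.Weight) (hα0 : α ≠ 0) (hα : α ∈ X.dotSet S) :
    List.TFAE
      [∀ μ ∈ M.supp, {s : ℕ | 0 < s ∧ μ + s • α ∈ M.supp}.Finite,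
       ∃ μ ∈ M.supp, {s : ℕ | 0 < s ∧ μ + s • α ∈ M.supp}.Finite,
       ∀ k : ℤ, (α, k) ∈ S → ∀ x : X.subalg ζ S,
         x ≠ 0 → (x : Loop X.Index) ∈ X.rootSpace ζ (α, k) → M.LocNilp x,
       ∃ k : ℤ, (α, k) ∈ S ∧ ∃ x : X.subalg ζ S,
         x ≠ 0 ∧ (x : Loop X.Index) ∈ X.rootSpace ζ (α, k) ∧ M.LocNilp x] := by
  have hnorm : ‖ζ‖ = 1 := hζ.norm'_eq_one X.order_ne_zero
  have hζ0 : ζ ≠ 0 := fun h => by simp [h] at hnorm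
  have h0 : (0 : X.RootLattice) ∈ S := him 0
  have := hsimple.1
  tfae_have 1 → 2 := by
    intro h
    obtain ⟨μ, hμ⟩ := M.supp_nonempty hfin
    exact ⟨μ, hμ, h μ hμ⟩
  tfae_have 2 → 3 := by
    rintro ⟨μ, hμ, hfinite⟩ k hk x - ⟨x', hx', hx⟩
    have he := AffineType.mem_pglPart_zero_of_evenRoot hα0 (hS hk) hx'
    obtain ⟨v, hv, hv0⟩ := Submodule.exists_mem_ne_zero_of_ne_bot hμ
    -- The finite set records positive `s` only; excluding `0` as well makes the weight space at `μ
    -- + nα` vanish.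
    obtain ⟨n, hn⟩ := (hfinite.union (Set.finite_singleton 0)).exists_notMem
    have hn' : M.weightSpace (μ + n • α) = ⊥ := by
      by_contra hne
      rcases Nat.eq_zero_or_pos n with h | h
      · exact hn (Or.inr h)
      · exact hn (Or.inl ⟨h, hne⟩)
    have hxn := M.act_pow_mem_weightSpace he hx' hx.symm hv n
    rw [hn', Submodule.mem_bot] at hxn
    exact SuperModule.locNilp_of_pow_act_eq_zero hζ0 hclosed hshift h0 hsimple hα0 hk he hx'
      hx.symm hv0 hxn
  tfae_have 3 → 4 := by
    intro h
    obtain ⟨k, hk⟩ := hα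
    obtain ⟨f, ⟨hf, -⟩, hne⟩ := Submodule.exists_mem_ne_zero_of_ne_bot (hS hk)
    have hfS := AffineType.rootSpace_le_subalg (Or.inl hk) hf
    have hne' : (⟨f, hfS⟩ : X.subalg ζ S) ≠ 0 := fun h => hne (congrArg Subtype.val h)
    exact ⟨k, hk, ⟨f, hfS⟩, hne', hf, h k hk _ hne' hf⟩
  tfae_have 4 → 1 := by
    rintro ⟨k, hk, x, hx0, hx, hnil⟩ μ -
    exact SuperModule.finite_string_of_locNilp hnorm hS hsymm hfin hα0 hk hx0 hx hnil μ
  tfae_finish
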